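/- Let $N\ge 3$ and write $x=(x',x_N)\in\mathbb R^{N-1}\times\mathbb R$ for points of $\mathbb R^N$. Let $u$ be an $x_N$-monotone solution of the obstacle problem, that is, $u\in C^{1,1}_{\rm loc}(\mathbb R^N)$, $u\ge 0$, $\Delta u=\chi_{\{u>0\}}$ in $\mathbb R^N$ (in the sense of distributions), and, with the coincidence set $\mathcal C:=\{u=0\}$: (i) $\mathcal C$ has non-empty interior; (ii) $\mathcal C\subset\{x_N\ge 0\}$ and $0\in\partial\mathcal C$; (iii) $\partial_N u\le 0$ in $\mathbb R^N$; (iv) there is a symmetric positive definite matrix $Q\in\mathbb R^{(N-1)\times(N-1)}$ with $\operatorname{tr}(Q)=1$ such that, as $r\to\infty$, $\frac{u(rx)}{r^2}\to p(x):=\frac12\,x'^{T}Qx'$ in $C^{1,\alpha}_{\rm loc}(\mathbb R^N)$ for each $\alpha\in(0,1)$. For $x,y\in\mathbb R^N$ with $y\ne0$, $y\neq x$ put $$G(x,y):=\frac1{|x-y|^{N-2}}-\frac1{|y|^{N-2}}-(N-2)\frac{x\cdot y}{|y|^N}.$$ Then the generalized Newtonian potential of $\mathcal C$ is well-defined, that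 is, $\mathcal C$ is measurable and $G(x,\cdot)\chi_{\mathcal C}\in L^1(\mathbb R^N)$ for every $x\in\mathbb R^N$, and, with $$V_{\mathcal C}(x):=\frac{1}{N(N-2)|B_1|}\int_{\mathcal C}G(x,y)\,dy,$$ where $|B_1|$ is the volume of the unit ball of $\mathbb R^N$, the expansion $$u(x)=p(x)+V_{\mathcal C}(x)\qquad\text{for all }x\in\mathbb R^N$$ holds. -/

import Mathlib

open MeasureTheory Filter Topology Set
open scoped ContDiff Laplacian RealInnerProductSpace Matrix

noncomputable section

/-- A global solution of the obstacle problem `Δu = χ_{u > 0}`, `u ≥ 0` in `ℝ^N`: a nonnegative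
function of class `C^{1,1}_loc` that satisfies the equation in the sense of distributions. -/
structure IsGlobalObstacleSolution {N : ℕ} (u : EuclideanSpace ℝ (Fin N) → ℝ) : Prop where
  differentiable : Differentiable ℝ u
  locallyLipschitz_fderiv : LocallyLipschitz (fderiv ℝ u)
  nonneg : ∀ x, 0 ≤ u x
  equation : ∀ φ : EuclideanSpace ℝ (Fin N) → ℝ, ContDiff ℝ ∞ φ → HasCompactSupport φ →
    ∫ x, u x * (Δ φ) x = ∫ x in {x | 0 < u x}, φ x

/-- The coincidence set `{u = 0}`. -/
def coincidenceSet {N : ℕ} (u : EuclideanSpace ℝ (Fin N) → ℝ) : Set (EuclideanSpace ℝ (Fin N)) :=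
  {x | u x = 0}

/-- `f r → g` in `C^{1,α}_loc(ℝ^N)` as `r → ∞`: on every ball the supremum of the difference, the
supremum of its derivative and the `α`-Hölder seminorm of its derivative tend to zero. -/
def TendstoC1HolderLoc {N : ℕ} (α : ℝ) (f : ℝ → EuclideanSpace ℝ (Fin N) → ℝ)
    (g : EuclideanSpace ℝ (Fin N) → ℝ) : Prop :=
  ∀ R > 0, ∀ ε > 0, ∀ᶠ r in atTop,
    (∀ x ∈ Metric.closedBall (0 : EuclideanSpace ℝ (Fin N)) R, |f r x - g x| ≤ ε) ∧
    (∀ x ∈ Metric.closedBall (0 : EuclideanSpace ℝ (Fin N)) R,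
      ‖fderiv ℝ (f r) x - fderiv ℝ g x‖ ≤ ε) ∧
    (∀ x ∈ Metric.closedBall (0 : EuclideanSpace ℝ (Fin N)) R,
      ∀ y ∈ Metric.closedBall (0 : EuclideanSpace ℝ (Fin N)) R,
        ‖(fderiv ℝ (f r) x - fderiv ℝ g x) - (fderiv ℝ (f r) y - fderiv ℝ g y)‖
          ≤ ε * ‖x - y‖ ^ α)

/-- `p` is the blow-down limit of `u`: `u(r x) / r² → p(x)` in `C^{1,α}_loc` as `r → ∞`, for each
`α ∈ (0,1)`. -/
def IsBlowDownLimit {N : ℕ} (u p : EuclideanSpace ℝ (Fin N) → ℝ) : Prop :=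
  ∀ α ∈ Ioo (0 : ℝ) 1, TendstoC1HolderLoc α (fun r x => u (r • x) / r ^ 2) p

/-- The quadratic polynomial `x = (x', x_N) ↦ ½ x'ᵀ Q x'` on `ℝ^N`, where `N = n + 1` and `x'`
consists of the first `n` coordinates. -/
def horizontalQuadratic {n : ℕ} (Q : Matrix (Fin n) (Fin n) ℝ)
    (x : EuclideanSpace ℝ (Fin (n + 1))) : ℝ :=
  (1 / 2) * ((fun i : Fin n => x i.castSucc) ⬝ᵥ (Q *ᵥ fun i : Fin n => x i.castSucc))

/-- `x_N`-monotone solutions of the obstacle problem in `ℝ^N`, where `N = n + 1`. Over the reals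
`Matrix.PosDef` means symmetric and positive definite. -/
structure IsXNMonotoneSolution {n : ℕ} (u : EuclideanSpace ℝ (Fin (n + 1)) → ℝ) : Prop where
  solution : IsGlobalObstacleSolution u
  interior_nonempty : (interior (coincidenceSet u)).Nonempty
  subset_halfSpace : ∀ x ∈ coincidenceSet u, 0 ≤ x (Fin.last n)
  zero_mem_frontier : 0 ∈ frontier (coincidenceSet u)
  monotone : ∀ x, fderiv ℝ u x (EuclideanSpace.single (Fin.last n) 1) ≤ 0
  blowDown : ∃ Q : Matrix (Fin n) (Fin n) ℝ,
    Q.PosDef ∧ Q.trace = 1 ∧ IsBlowDownLimit u (horizontalQuadratic Q)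

/-- The kernel `G(x,y) = |x-y|^{2-N} - |y|^{2-N} - (N-2) x·y / |y|^N`, for `N ≥ 3`. -/
def newtonKernel {N : ℕ} (x y : EuclideanSpace ℝ (Fin N)) : ℝ :=
  1 / ‖x - y‖ ^ (N - 2) - 1 / ‖y‖ ^ (N - 2) - ((N : ℝ) - 2) * (⟪x, y⟫ / ‖y‖ ^ N)

/-- The generalized Newtonian potential of `M` is well-defined: `G(x,·) χ_M ∈ L¹(ℝ^N)` for all
`x`. -/
def HasNewtonPotential {N : ℕ} (M : Set (EuclideanSpace ℝ (Fin N))) : Prop :=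
  MeasurableSet M ∧ ∀ x, Integrable (M.indicator (newtonKernel x)) volume

/-- The generalized Newtonian potential `V_M(x) = α_N ∫_M G(x,y) dy` with
`α_N = 1 / (N (N-2) |B_1|)`. -/
def newtonPotential {N : ℕ} (M : Set (EuclideanSpace ℝ (Fin N)))
    (x : EuclideanSpace ℝ (Fin N)) : ℝ :=
  1 / ((N : ℝ) * ((N : ℝ) - 2) *
      volume.real (Metric.ball (0 : EuclideanSpace ℝ (Fin N)) 1)) *
    ∫ y in M, newtonKernel x y

end

/-!
Write `w = u - p`, `C = {u = 0}`, `d = N`. Since `Δp = tr Q = 1`, the function `w` satisfies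
`Δw = -χ_C` in the sense of distributions; by the blow-down assumption it is `o(‖y‖²)` at infinity,
and it vanishes to first order at the origin, because `u` and `p` are nonnegative and vanish there
(`IsSubquadraticPotential`). These properties alone give the expansion, without a Liouville theorem:

* A smooth `H` that is harmonic outside a ball and is `O(‖y‖⁻ᵈ)` there, with gradient
  `O(‖y‖⁻ᵈ⁻¹)`, can be used as a test function in `Δw = -χ_C`. Cutting it off at radius `R` costs an
  error `o(R²) · O(R⁻ᵈ⁻²) · O(Rᵈ)`, which tends to zero
  (`IsSubquadraticPotential.tendsto_setIntegral_mul_cutoff`).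
* For `H` take the second vertical derivative of the kernel `‖y‖^{2-d}`, smoothed near the origin.
  It is homogeneous of degree `-d` far out and positive near the `x_N`-axis. As `Q` is positive
  definite, the blow-down assumption forces `C` to be close to that axis at infinity
  (`IsBlowDownLimit.exists_le_dirDeriv_newtonFund`). The resulting bound on `∫_C H` shows that
  `‖y‖⁻ᵈ` is integrable on the far part of `C`
  (`IsSubquadraticPotential.integrableOn_inv_norm_pow`). This is exactly the decay of `G(x, ·)`, so
  the generalized Newtonian potential of `C` is well-defined.
* For `H` take next the kernel `G(x, ·)` with `‖y‖^{2-d}` replaced by a smooth function that differs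
  from it only on a ball of radius `ε`. Its Laplacian is a smooth approximation of a multiple of
  `δ_x - δ_0 + x · ∇δ_0`. As `ε → 0`, the pairing with `w` tends to that multiple of
  `w x - w 0 - x · ∇w 0 = w x`, and the other side tends to `∫_C G(x, y) dy` by dominated
  convergence (`IsSubquadraticPotential.setIntegral_renormalizedKernel`).
-/

/-! ### Directional derivatives, the Laplacian and Green's identity -/

section Calculus

variable {E : Type*} [NormedAddCommGroup E] [InnerProductSpace ℝ E]

/-- The derivative of a function in a fixed direction, as a function of the point. -/
noncomputable def dirDeriv (v : E) (f : E → ℝ) (y : E) : ℝ := fderiv ℝ f y v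

theorem ContDiff.dirDeriv {f : E → ℝ} (hf : ContDiff ℝ ∞ f) (v : E) :
    ContDiff ℝ ∞ (dirDeriv v f) :=
  (hf.fderiv_right (m := ∞) (by simp)).clm_apply contDiff_const

theorem ContDiff.differentiable_infty {f : E → ℝ} (hf : ContDiff ℝ ∞ f) : Differentiable ℝ f :=
  hf.differentiable (by simp)

theorem fderiv_dirDeriv {f : E → ℝ} {y : E} (hf : ContDiffAt ℝ 2 f y) (v w : E) :
    fderiv ℝ (dirDeriv v f) y w = fderiv ℝ (fderiv ℝ f) y w v := by
  have h : DifferentiableAt ℝ (fderiv ℝ f) y :=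
    (hf.fderiv_right (m := 1) (by norm_num)).differentiableAt (by simp)
  have : HasFDerivAt (dirDeriv v f) ((fderiv ℝ (fderiv ℝ f) y).flip v) y := by
    have := h.hasFDerivAt.clm_apply (hasFDerivAt_const v y)
    simp only [ContinuousLinearMap.comp_zero, zero_add] at this
    exact this
  rw [this.fderiv]
  rfl

theorem dirDeriv_comm {f : E → ℝ} (hf : ContDiff ℝ ∞ f) (v w : E) :
    dirDeriv v (dirDeriv w f) = dirDeriv w (dirDeriv v f) := by
  ext y
  have h2 : ContDiffAt ℝ 2 f y := (contDiff_infty.1 hf 2).contDiffAt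
  rw [dirDeriv, dirDeriv, fderiv_dirDeriv h2, fderiv_dirDeriv h2]
  exact (h2.isSymmSndFDerivAt (by simp)).eq v w

theorem dirDeriv_add {f g : E → ℝ} (hf : Differentiable ℝ f) (hg : Differentiable ℝ g) (v : E) :
    dirDeriv v (fun y => f y + g y) = fun y => dirDeriv v f y + dirDeriv v g y := by
  ext y
  simp [dirDeriv, fderiv_fun_add (hf y) (hg y)]

theorem dirDeriv_sum {ι : Type*} (s : Finset ι) {f : ι → E → ℝ}
    (hf : ∀ i ∈ s, Differentiable ℝ (f i)) (v : E) :
    dirDeriv v (fun y => ∑ i ∈ s, f i y) = fun y => ∑ i ∈ s, dirDeriv v (f i) y := by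
  ext y
  simp [dirDeriv, fderiv_fun_sum fun i hi => hf i hi y]

theorem dirDeriv_mul {f g : E → ℝ} (hf : Differentiable ℝ f) (hg : Differentiable ℝ g) (v : E) :
    dirDeriv v (fun y => f y * g y) = fun y => f y * dirDeriv v g y + dirDeriv v f y * g y := by
  ext y
  simp [dirDeriv, fderiv_fun_mul (hf y) (hg y), mul_comm]

theorem dirDeriv_comp_smul (f : E → ℝ) (c : ℝ) (v : E) :
    dirDeriv v (fun y => f (c • y)) = fun y => c * dirDeriv v f (c • y) := by
  ext y
  simp [dirDeriv, fderiv_comp_smul]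

theorem HasCompactSupport.dirDeriv {f : E → ℝ} (hf : HasCompactSupport f) (v : E) :
    HasCompactSupport (dirDeriv v f) :=
  hf.fderiv_apply ℝ v

theorem norm_dirDeriv_le (f : E → ℝ) (v y : E) : |dirDeriv v f y| ≤ ‖fderiv ℝ f y‖ * ‖v‖ :=
  (fderiv ℝ f y).le_opNorm v

variable [FiniteDimensional ℝ E]

theorem laplacian_eq_sum_dirDeriv_of_contDiffAt {ι : Type*} [Fintype ι]
    (b : OrthonormalBasis ι ℝ E) {f : E → ℝ} {y : E} (hf : ContDiffAt ℝ 2 f y) :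
    (Δ f) y = ∑ i, dirDeriv (b i) (dirDeriv (b i) f) y := by
  rw [InnerProductSpace.laplacian_eq_iteratedFDeriv_orthonormalBasis f b]
  refine Finset.sum_congr rfl fun i _ => ?_
  rw [iteratedFDeriv_two_apply, dirDeriv, fderiv_dirDeriv hf]
  simp

theorem laplacian_eq_sum_dirDeriv {ι : Type*} [Fintype ι] (b : OrthonormalBasis ι ℝ E)
    {f : E → ℝ} (hf : ContDiff ℝ ∞ f) :
    Δ f = fun y => ∑ i, dirDeriv (b i) (dirDeriv (b i) f) y := by
  ext y
  exact laplacian_eq_sum_dirDeriv_of_contDiffAt b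
    ((contDiff_infty.1 hf 2).contDiffAt)

theorem ContDiff.laplacian {f : E → ℝ} (hf : ContDiff ℝ ∞ f) : ContDiff ℝ ∞ (Δ f) := by
  rw [laplacian_eq_sum_dirDeriv (stdOrthonormalBasis ℝ E) hf]
  exact ContDiff.sum fun i _ => (hf.dirDeriv _).dirDeriv _

/-- The Laplacian commutes with directional derivatives, by symmetry of third derivatives. -/
theorem laplacian_dirDeriv {f : E → ℝ} (hf : ContDiff ℝ ∞ f) (v : E) :
    Δ (dirDeriv v f) = dirDeriv v (Δ f) := by
  rw [laplacian_eq_sum_dirDeriv (stdOrthonormalBasis ℝ E) hf,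
    laplacian_eq_sum_dirDeriv (stdOrthonormalBasis ℝ E) (hf.dirDeriv v),
    dirDeriv_sum _ fun i _ => ((hf.dirDeriv _).dirDeriv _).differentiable_infty]
  ext y
  refine Finset.sum_congr rfl fun i _ => ?_
  rw [dirDeriv_comm hf _ v, dirDeriv_comm (hf.dirDeriv _) _ v]

theorem laplacian_mul {f g : E → ℝ} (hf : ContDiff ℝ ∞ f) (hg : ContDiff ℝ ∞ g) (y : E) :
    (Δ fun z => f z * g z) y = f y * (Δ g) y + (Δ f) y * g y +
      2 * ∑ i, dirDeriv (stdOrthonormalBasis ℝ E i) f y *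
        dirDeriv (stdOrthonormalBasis ℝ E i) g y := by
  rw [laplacian_eq_sum_dirDeriv (stdOrthonormalBasis ℝ E) (hf.mul hg),
    laplacian_eq_sum_dirDeriv (stdOrthonormalBasis ℝ E) hf,
    laplacian_eq_sum_dirDeriv (stdOrthonormalBasis ℝ E) hg]
  simp only [Finset.mul_sum, Finset.sum_mul, ← Finset.sum_add_distrib]
  refine Finset.sum_congr rfl fun i _ => ?_
  set v := stdOrthonormalBasis ℝ E i
  have hf' := (hf.dirDeriv v)
  have hg' := (hg.dirDeriv v)
  rw [dirDeriv_mul hf.differentiable_infty hg.differentiable_infty,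
    dirDeriv_add (hf.mul hg').differentiable_infty (hf'.mul hg).differentiable_infty,
    dirDeriv_mul hf.differentiable_infty hg'.differentiable_infty,
    dirDeriv_mul hf'.differentiable_infty hg.differentiable_infty]
  ring

theorem laplacian_comp_smul {f : E → ℝ} (hf : ContDiff ℝ ∞ f) (c : ℝ) :
    (Δ fun z => f (c • z)) = fun y => c ^ 2 * (Δ f) (c • y) := by
  have hf' : ContDiff ℝ ∞ fun z : E => f (c • z) := hf.comp (contDiff_const_smul c)
  rw [laplacian_eq_sum_dirDeriv (stdOrthonormalBasis ℝ E) hf,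
    laplacian_eq_sum_dirDeriv (stdOrthonormalBasis ℝ E) hf']
  ext y
  rw [Finset.mul_sum]
  refine Finset.sum_congr rfl fun i _ => ?_
  set v := stdOrthonormalBasis ℝ E i
  have h : dirDeriv v (fun y => c * dirDeriv v f (c • y)) y
      = c * dirDeriv v (fun y => dirDeriv v f (c • y)) y := by
    have : DifferentiableAt ℝ (fun y => dirDeriv v f (c • y)) y :=
      ((hf.dirDeriv v).comp (contDiff_const_smul c)).differentiable_infty y
    simpa using! congrArg (fun L => L v) (fderiv_const_mul this c)
  rw [dirDeriv_comp_smul, h, dirDeriv_comp_smul]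
  ring

theorem HasCompactSupport.laplacian {f : E → ℝ} (hc : HasCompactSupport f) :
    HasCompactSupport (Δ f) := by
  refine hc.mono' fun y hy => ?_
  by_contra h
  have : f =ᶠ[𝓝 y] fun _ => 0 := notMem_tsupport_iff_eventuallyEq.1 h
  exact hy (by simpa using (InnerProductSpace.laplacian_congr_nhds this).eq_of_nhds)

variable [MeasurableSpace E] [BorelSpace E]

/-- Green's second identity against a compactly supported function. -/
theorem integral_mul_laplacian_comm {f φ : E → ℝ} (hf : ContDiff ℝ ∞ f) (hφ : ContDiff ℝ ∞ φ)
    (hc : HasCompactSupport φ) : ∫ y, f y * (Δ φ) y = ∫ y, (Δ f) y * φ y := by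
  have key : ∀ {g ρ : E → ℝ} (v : E), ContDiff ℝ ∞ g → ContDiff ℝ ∞ ρ → HasCompactSupport ρ →
      ∫ y, g y * dirDeriv v ρ y = - ∫ y, dirDeriv v g y * ρ y := by
    intro g ρ v hg hρ hc
    refine integral_mul_fderiv_eq_neg_fderiv_mul_of_integrable ?_ ?_ ?_
      (fun y _ => hg.differentiable_infty y) (fun y _ => hρ.differentiable_infty y)
    · exact ((hg.dirDeriv v).continuous.mul hρ.continuous).integrable_of_hasCompactSupport
        hc.mul_left
    · exact (hg.continuous.mul (hρ.dirDeriv v).continuous).integrable_of_hasCompactSupport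
        (hc.dirDeriv v).mul_left
    · exact (hg.continuous.mul hρ.continuous).integrable_of_hasCompactSupport hc.mul_left
  rw [laplacian_eq_sum_dirDeriv (stdOrthonormalBasis ℝ E) hf,
    laplacian_eq_sum_dirDeriv (stdOrthonormalBasis ℝ E) hφ]
  simp only [Finset.mul_sum, Finset.sum_mul]
  rw [integral_finsetSum, integral_finsetSum]
  · refine Finset.sum_congr rfl fun i _ => ?_
    rw [key _ hf (hφ.dirDeriv _) (hc.dirDeriv _), key _ (hf.dirDeriv _) hφ hc, neg_neg]
  · intro i _
    exact (((hf.dirDeriv _).dirDeriv _).continuous.mul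
      hφ.continuous).integrable_of_hasCompactSupport hc.mul_left
  · intro i _
    exact (hf.continuous.mul
      ((hφ.dirDeriv _).dirDeriv _).continuous).integrable_of_hasCompactSupport
      ((hc.dirDeriv _).dirDeriv _).mul_left

end Calculus

/-! ### Radial functions, homogeneous functions and the Taylor remainder -/

section Radial

variable {E : Type*} [NormedAddCommGroup E] [InnerProductSpace ℝ E]

theorem dirDeriv_radial {g : ℝ → ℝ} {y : E} (hg : DifferentiableAt ℝ g (‖y‖ ^ 2)) (v : E) :
    dirDeriv v (fun z => g (‖z‖ ^ 2)) y = deriv g (‖y‖ ^ 2) * (2 * ⟪y, v⟫) := by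
  have h := hg.hasDerivAt.comp_hasFDerivAt y (hasStrictFDerivAt_norm_sq y).hasFDerivAt
  have h' : HasFDerivAt (fun z : E => g (‖z‖ ^ 2)) _ y := h
  rw [dirDeriv, h'.fderiv]
  simp

theorem dirDeriv_dirDeriv_radial {g : ℝ → ℝ} {y : E} (hg : ContDiffAt ℝ 2 g (‖y‖ ^ 2)) (v : E) :
    dirDeriv v (dirDeriv v (fun z => g (‖z‖ ^ 2))) y =
      4 * deriv (deriv g) (‖y‖ ^ 2) * ⟪y, v⟫ ^ 2 + 2 * deriv g (‖y‖ ^ 2) * ‖v‖ ^ 2 := by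
  have hcont : ContinuousAt (fun z : E => ‖z‖ ^ 2) y := by fun_prop
  have h1 : dirDeriv v (fun z => g (‖z‖ ^ 2)) =ᶠ[𝓝 y]
      fun z => deriv g (‖z‖ ^ 2) * (2 * ⟪z, v⟫) := by
    filter_upwards [hcont.eventually (hg.eventually (by simp))] with z hz
    exact dirDeriv_radial (hz.differentiableAt (by simp)) v
  have hd : DifferentiableAt ℝ (deriv g) (‖y‖ ^ 2) :=
    ((hg.fderiv_right (m := 1) (by norm_num)).differentiableAt (by simp)).clm_apply
      (differentiableAt_const (1 : ℝ))
  have h2 := hd.hasDerivAt.comp_hasFDerivAt y (hasStrictFDerivAt_norm_sq y).hasFDerivAt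
  have h3 : HasFDerivAt (fun z : E => 2 * ⟪z, v⟫) ((2 : ℝ) • (innerSL ℝ v)) y := by
    have : HasFDerivAt (fun z : E => ⟪v, z⟫) (innerSL ℝ v) y := (innerSL ℝ v).hasFDerivAt
    simpa [real_inner_comm] using this.const_mul 2
  have h4 := h2.mul h3
  have h5 : HasFDerivAt (fun z => deriv g (‖z‖ ^ 2) * (2 * ⟪z, v⟫)) _ y := h4
  rw [dirDeriv, h1.fderiv_eq, h5.fderiv]
  simp
  ring

theorem laplacian_radial [FiniteDimensional ℝ E] {g : ℝ → ℝ} {y : E}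
    (hg : ContDiffAt ℝ 2 g (‖y‖ ^ 2)) :
    (Δ fun z : E => g (‖z‖ ^ 2)) y =
      4 * ‖y‖ ^ 2 * deriv (deriv g) (‖y‖ ^ 2) +
        2 * Module.finrank ℝ E * deriv g (‖y‖ ^ 2) := by
  have hf : ContDiffAt ℝ 2 (fun z : E => g (‖z‖ ^ 2)) y :=
    hg.comp y (contDiff_norm_sq ℝ).contDiffAt
  rw [laplacian_eq_sum_dirDeriv_of_contDiffAt (stdOrthonormalBasis ℝ E) hf]
  simp only [dirDeriv_dirDeriv_radial hg, OrthonormalBasis.norm_eq_one, Finset.sum_add_distrib,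
    ← Finset.mul_sum]
  rw [(stdOrthonormalBasis ℝ E).sum_sq_inner_left]
  simp
  ring

end Radial

section Homogeneous

variable {E F : Type*} [NormedAddCommGroup E] [NormedSpace ℝ E] [NormedAddCommGroup F]
  [NormedSpace ℝ F]

/-- A function positively homogeneous of degree `-m` away from the origin. -/
def IsHomogeneousOfNegDegree (m : ℕ) (f : E → F) : Prop :=
  ∀ t : ℝ, 0 < t → ∀ y : E, y ≠ 0 → f (t • y) = (t ^ m)⁻¹ • f y

theorem IsHomogeneousOfNegDegree.fderiv {m : ℕ} {f : E → F} (h : IsHomogeneousOfNegDegree m f)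
    (hf : ∀ y ≠ 0, DifferentiableAt ℝ f y) :
    IsHomogeneousOfNegDegree (m + 1) (fderiv ℝ f) := by
  intro t ht y hy
  have h1 : (fun z => f (t • z)) =ᶠ[𝓝 y] fun z => (t ^ m)⁻¹ • f z := by
    filter_upwards [isOpen_ne.mem_nhds hy] with z hz using h t ht z hz
  have h2 := h1.fderiv_eq (𝕜 := ℝ)
  rw [fderiv_comp_smul, fderiv_fun_const_smul (hf y hy)] at h2
  rw [pow_succ', mul_inv, mul_smul, ← h2, smul_smul, inv_mul_cancel₀ ht.ne', one_smul]

/-- By compactness of the unit sphere, a homogeneous function of degree `-m` that is continuous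
away from the origin is `O(‖y‖⁻ᵐ)`. -/
theorem IsHomogeneousOfNegDegree.exists_bound [FiniteDimensional ℝ E] {m : ℕ} {f : E → F}
    (h : IsHomogeneousOfNegDegree m f) (hf : ∀ y ≠ 0, ContinuousAt f y) :
    ∃ K, 0 ≤ K ∧ ∀ y ≠ 0, ‖f y‖ ≤ K / ‖y‖ ^ m := by
  have hc : ContinuousOn f (Metric.sphere 0 1) := fun y hy =>
    (hf y (ne_zero_of_mem_unit_sphere ⟨y, hy⟩)).continuousWithinAt
  obtain ⟨K, hK⟩ := (isCompact_sphere (0 : E) 1).exists_bound_of_continuousOn hc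
  refine ⟨max K 0, le_max_right _ _, fun y hy => ?_⟩
  have hy' : 0 < ‖y‖ := norm_pos_iff.2 hy
  have hs : ‖‖y‖⁻¹ • y‖ = 1 := by
    rw [norm_smul, norm_inv, norm_norm, inv_mul_cancel₀ hy'.ne']
  have h0 : ‖y‖⁻¹ • y ≠ 0 := by rw [← norm_ne_zero_iff, hs]; norm_num
  have h1 := h ‖y‖ hy' (‖y‖⁻¹ • y) h0
  rw [smul_smul, mul_inv_cancel₀ hy'.ne', one_smul] at h1
  rw [h1, norm_smul, norm_inv, norm_pow, norm_norm, div_eq_inv_mul]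
  gcongr
  exact (hK _ (by simpa using hs)).trans (le_max_left _ _)

/-- The first-order Taylor remainder is controlled by the second derivative. -/
theorem norm_taylor_remainder_le {f : E → F} {s : Set E} (hs : Convex ℝ s) {K : ℝ}
    (hf : ∀ z ∈ s, ContDiffAt ℝ 2 f z) (hK : ∀ z ∈ s, ‖fderiv ℝ (fderiv ℝ f) z‖ ≤ K)
    {x y : E} (hy : y ∈ s) (hyx : y - x ∈ s) :
    ‖f (y - x) - f y + fderiv ℝ f y x‖ ≤ K * ‖x‖ ^ 2 := by
  have hK0 : 0 ≤ K := (norm_nonneg (fderiv ℝ (fderiv ℝ f) y)).trans (hK y hy)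
  have hs' : segment ℝ y (y - x) ⊆ s := hs.segment_subset hy hyx
  have hd : ∀ z ∈ s, ‖fderiv ℝ f z - fderiv ℝ f y‖ ≤ K * ‖z - y‖ := fun z hz =>
    hs.norm_image_sub_le_of_norm_fderiv_le (𝕜 := ℝ)
      (fun w hw => ((hf w hw).fderiv_right (m := 1) (by norm_num)).differentiableAt (by simp))
      hK hy hz
  have := (convex_segment y (y - x)).norm_image_sub_le_of_norm_fderiv_le' (𝕜 := ℝ) (f := f)
    (φ := fderiv ℝ f y) (C := K * ‖x‖)
    (fun z hz => (hf z (hs' hz)).differentiableAt (by simp)) (fun z hz => ?_)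
    (left_mem_segment ℝ _ _) (right_mem_segment ℝ _ _)
  · calc _ = ‖f (y - x) - f y - fderiv ℝ f y (y - x - y)‖ := by
            congr 1; rw [show y - x - y = -x by abel, map_neg, sub_neg_eq_add]
      _ ≤ _ := this
      _ = _ := by rw [show y - x - y = -x by abel, norm_neg]; ring
  · refine (hd z (hs' hz)).trans ?_
    gcongr
    have := norm_sub_le_of_mem_segment hz
    simpa using this

end Homogeneous

/-! ### The Newtonian kernel and its smooth truncations -/

section Newton

variable {E : Type*} [NormedAddCommGroup E] [InnerProductSpace ℝ E]

local notation "dim" => Module.finrank ℝ E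

/-- The Newtonian kernel `‖y‖^{2-d}` in dimension `d`, without its normalizing constant. At the
origin it takes the junk value `0`. -/
noncomputable def newtonFund (y : E) : ℝ := 1 / ‖y‖ ^ (dim - 2)

/-- A smooth function of `s` that vanishes for `s ≤ 1/2` and equals `s^{1-d/2}` for `s ≥ 1`.
The real power is only singular where the transition function vanishes. -/
noncomputable def truncProfile (d : ℕ) (s : ℝ) : ℝ :=
  Real.smoothTransition (2 * s - 1) * s ^ (1 - d / 2 : ℝ)

/-- A smooth function on the whole space that agrees with the Newtonian kernel outside the unit
ball. -/
noncomputable def truncFund (y : E) : ℝ := truncProfile dim (‖y‖ ^ 2)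

/-- The rescaling of `truncFund` that agrees with the Newtonian kernel outside the ball of
radius `ε`. -/
noncomputable def scaledTruncFund (ε : ℝ) (y : E) : ℝ := (ε ^ (dim - 2))⁻¹ * truncFund (ε⁻¹ • y)

theorem newtonFund_eq_rpow (hd : 3 ≤ dim) (y : E) :
    newtonFund y = (‖y‖ ^ 2) ^ (1 - dim / 2 : ℝ) := by
  have h2 : ((dim - 2 : ℕ) : ℝ) = (dim : ℝ) - 2 := by
    rw [Nat.cast_sub (by omega)]; norm_num
  rw [newtonFund, one_div, ← Real.rpow_natCast, ← Real.rpow_neg (norm_nonneg y), h2,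
    ← Real.rpow_natCast, ← Real.rpow_mul (norm_nonneg y)]
  congr 1
  push_cast
  ring

theorem contDiffAt_newtonFund {y : E} (hy : y ≠ 0) {n : WithTop ℕ∞} :
    ContDiffAt ℝ n (newtonFund : E → ℝ) y := by
  have : ContDiffAt ℝ n (fun z : E => ‖z‖ ^ (dim - 2)) y := (contDiffAt_norm ℝ hy).pow _
  exact contDiffAt_const.div this (pow_ne_zero _ (norm_ne_zero_iff.2 hy))

theorem isHomogeneous_newtonFund : IsHomogeneousOfNegDegree (dim - 2) (newtonFund : E → ℝ) := by
  intro t ht y _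
  simp [newtonFund, norm_smul, abs_of_pos ht, mul_pow, mul_comm]

theorem deriv_rpow_const_eventuallyEq (a : ℝ) {s : ℝ} (hs : 0 < s) :
    deriv (fun t : ℝ => t ^ a) =ᶠ[𝓝 s] fun t => a * t ^ (a - 1) := by
  filter_upwards [isOpen_ne.mem_nhds hs.ne'] with t ht
  exact (Real.hasDerivAt_rpow_const (Or.inl ht)).deriv

theorem deriv_deriv_rpow_const (a : ℝ) {s : ℝ} (hs : 0 < s) :
    deriv (deriv fun t : ℝ => t ^ a) s = a * ((a - 1) * s ^ (a - 1 - 1)) := by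
  rw [(deriv_rpow_const_eventuallyEq a hs).deriv_eq]
  exact ((Real.hasDerivAt_rpow_const (Or.inl hs.ne')).const_mul a).deriv

theorem newtonFund_eq_radial (hd : 3 ≤ dim) :
    (newtonFund : E → ℝ) = fun y => (fun s : ℝ => s ^ (1 - dim / 2 : ℝ)) (‖y‖ ^ 2) :=
  funext (newtonFund_eq_rpow hd)

theorem fderiv_newtonFund (hd : 3 ≤ dim) {y : E} (hy : y ≠ 0) (x : E) :
    fderiv ℝ newtonFund y x = -((dim : ℝ) - 2) * (⟪x, y⟫ / ‖y‖ ^ dim) := by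
  have hy' : 0 < ‖y‖ := norm_pos_iff.2 hy
  have hs : 0 < ‖y‖ ^ 2 := by positivity
  have h := dirDeriv_radial (g := fun s : ℝ => s ^ (1 - dim / 2 : ℝ))
    (Real.hasDerivAt_rpow_const (Or.inl hs.ne')).differentiableAt x
  rw [← newtonFund_eq_radial hd, dirDeriv, (deriv_rpow_const_eventuallyEq _ hs).eq_of_nhds] at h
  have h3 : (‖y‖ ^ 2) ^ (1 - dim / 2 - 1 : ℝ) = (‖y‖ ^ dim)⁻¹ := by
    rw [← Real.rpow_natCast, ← Real.rpow_natCast, ← Real.rpow_mul hy'.le, ← Real.rpow_neg hy'.le]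
    congr 1
    push_cast
    ring
  rw [h, h3, real_inner_comm]
  ring

theorem dirDeriv_dirDeriv_newtonFund_of_norm_eq_one (hd : 3 ≤ dim) {y : E} (hy : ‖y‖ = 1) (v : E) :
    dirDeriv v (dirDeriv v newtonFund) y =
      ((dim : ℝ) - 2) * (dim * ⟪y, v⟫ ^ 2 - ‖v‖ ^ 2) := by
  have hs : (0 : ℝ) < ‖y‖ ^ 2 := by rw [hy]; norm_num
  have h := dirDeriv_dirDeriv_radial (g := fun s : ℝ => s ^ (1 - dim / 2 : ℝ))
    (Real.contDiffAt_rpow_const (Or.inl hs.ne')) v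
  rw [← newtonFund_eq_radial hd, (deriv_rpow_const_eventuallyEq _ hs).eq_of_nhds,
    deriv_deriv_rpow_const _ hs, hy] at h
  rw [h]
  simp
  ring

theorem contDiff_truncProfile (d : ℕ) : ContDiff ℝ ∞ (truncProfile d) := by
  have h1 : ContDiff ℝ ∞ fun s : ℝ => Real.smoothTransition (2 * s - 1) :=
    Real.smoothTransition.contDiff.comp (by fun_prop)
  rw [contDiff_iff_contDiffAt]
  intro s
  rcases lt_or_ge s (1 / 2) with hs | hs
  · have : truncProfile d =ᶠ[𝓝 s] fun _ => 0 := by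
      filter_upwards [isOpen_Iio.mem_nhds hs] with t ht
      rw [truncProfile, Real.smoothTransition.zero_of_nonpos, zero_mul]
      have : t < 1 / 2 := ht
      linarith
    exact contDiffAt_const.congr_of_eventuallyEq this
  · have hs0 : s ≠ 0 := by linarith
    exact h1.contDiffAt.mul (contDiffAt_id.rpow_const_of_ne hs0)

theorem truncProfile_eq (d : ℕ) {s : ℝ} (hs : 1 ≤ s) : truncProfile d s = s ^ (1 - d / 2 : ℝ) := by
  rw [truncProfile, Real.smoothTransition.one_of_one_le (by linarith), one_mul]

theorem truncProfile_eventuallyEq (d : ℕ) {s : ℝ} (hs : 1 < s) :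
    truncProfile d =ᶠ[𝓝 s] fun s => s ^ (1 - d / 2 : ℝ) := by
  filter_upwards [isOpen_Ioi.mem_nhds hs] with t ht using truncProfile_eq d (le_of_lt ht)

theorem contDiff_truncFund : ContDiff ℝ ∞ (truncFund : E → ℝ) :=
  (contDiff_truncProfile _).comp (contDiff_norm_sq ℝ)

theorem truncFund_eq (hd : 3 ≤ dim) {y : E} (hy : 1 ≤ ‖y‖) : truncFund y = newtonFund y := by
  rw [truncFund, truncProfile_eq _ (one_le_pow₀ hy), newtonFund_eq_rpow hd]

theorem truncFund_eventuallyEq (hd : 3 ≤ dim) {y : E} (hy : 1 < ‖y‖) :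
    truncFund =ᶠ[𝓝 y] newtonFund := by
  filter_upwards [continuous_norm.continuousAt.eventually (isOpen_Ioi.mem_nhds hy)] with z hz
  exact truncFund_eq hd (le_of_lt hz)

theorem newtonFund_nonneg (y : E) : 0 ≤ newtonFund y := by
  rw [newtonFund]; positivity

theorem abs_truncFund_le (hd : 3 ≤ dim) (y : E) : |truncFund y| ≤ newtonFund y := by
  have h := newtonFund_nonneg y
  rw [truncFund, truncProfile, ← newtonFund_eq_rpow hd, abs_mul, abs_of_nonneg h,
    abs_of_nonneg (Real.smoothTransition.nonneg _)]
  exact mul_le_of_le_one_left h (Real.smoothTransition.le_one _)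

theorem contDiff_scaledTruncFund (ε : ℝ) : ContDiff ℝ ∞ (scaledTruncFund ε : E → ℝ) :=
  contDiff_const.mul (contDiff_truncFund.comp (contDiff_const_smul _))

theorem newtonFund_inv_smul {ε : ℝ} (hε : 0 < ε) (y : E) :
    (ε ^ (dim - 2))⁻¹ * newtonFund (ε⁻¹ • y) = newtonFund y := by
  simp only [newtonFund, norm_smul, norm_inv, Real.norm_of_nonneg hε.le, mul_pow, inv_pow]
  field_simp

theorem scaledTruncFund_eq (hd : 3 ≤ dim) {ε : ℝ} (hε : 0 < ε) {y : E} (hy : ε ≤ ‖y‖) :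
    scaledTruncFund ε y = newtonFund y := by
  rw [scaledTruncFund, truncFund_eq hd, newtonFund_inv_smul hε]
  rw [norm_smul, norm_inv, Real.norm_of_nonneg hε.le, inv_mul_eq_div]
  exact (one_le_div hε).2 hy

theorem scaledTruncFund_eventuallyEq (hd : 3 ≤ dim) {ε : ℝ} (hε : 0 < ε) {y : E} (hy : ε < ‖y‖) :
    scaledTruncFund ε =ᶠ[𝓝 y] newtonFund := by
  filter_upwards [continuous_norm.continuousAt.eventually (isOpen_Ioi.mem_nhds hy)] with z hz
  exact scaledTruncFund_eq hd hε (le_of_lt hz)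

theorem abs_scaledTruncFund_le (hd : 3 ≤ dim) {ε : ℝ} (hε : 0 < ε) (y : E) :
    |scaledTruncFund ε y| ≤ newtonFund y := by
  rw [scaledTruncFund, abs_mul, abs_of_nonneg (by positivity), ← newtonFund_inv_smul hε y]
  gcongr
  exact abs_truncFund_le hd _

section Laplacian

variable [FiniteDimensional ℝ E]

theorem laplacian_truncFund (y : E) : (Δ (truncFund : E → ℝ)) y =
    4 * ‖y‖ ^ 2 * deriv (deriv (truncProfile dim)) (‖y‖ ^ 2) +
      2 * dim * deriv (truncProfile dim) (‖y‖ ^ 2) :=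
  laplacian_radial (g := truncProfile dim) (contDiff_infty.1 (contDiff_truncProfile _) 2).contDiffAt

theorem laplacian_truncFund_eq_zero {y : E} (hy : 1 < ‖y‖) : (Δ (truncFund : E → ℝ)) y = 0 := by
  have hs : 1 < ‖y‖ ^ 2 := one_lt_pow₀ hy two_ne_zero
  have hs0 : 0 < ‖y‖ ^ 2 := by linarith
  have h := truncProfile_eventuallyEq dim hs
  rw [laplacian_truncFund, h.deriv_eq, h.deriv.deriv_eq, deriv_deriv_rpow_const _ hs0,
    (deriv_rpow_const_eventuallyEq _ hs0).eq_of_nhds, Real.rpow_sub_one hs0.ne' (_ - 1)]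
  field_simp
  ring

theorem hasCompactSupport_laplacian_truncFund : HasCompactSupport (Δ (truncFund : E → ℝ)) :=
  HasCompactSupport.intro (isCompact_closedBall (0 : E) 1) fun y hy =>
    laplacian_truncFund_eq_zero (by simpa using hy)

theorem laplacian_scaledTruncFund (hd : 3 ≤ dim) (ε : ℝ) :
    Δ (scaledTruncFund ε : E → ℝ) = fun y => (ε ^ dim)⁻¹ * (Δ (truncFund : E → ℝ)) (ε⁻¹ • y) := by
  have h1 : (scaledTruncFund ε : E → ℝ) =
      (ε ^ (dim - 2))⁻¹ • fun y => truncFund (ε⁻¹ • y) := rfl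
  ext y
  have hc : ContDiff ℝ ∞ fun y : E => truncFund (ε⁻¹ • y) :=
    contDiff_truncFund.comp (contDiff_const_smul _)
  rw [h1, InnerProductSpace.laplacian_smul _ (contDiff_infty.1 hc 2).contDiffAt,
    laplacian_comp_smul contDiff_truncFund]
  have : ε ^ dim = ε ^ (dim - 2) * ε ^ 2 := by rw [← pow_add]; congr 1; omega
  rw [this, smul_eq_mul, inv_pow, ← mul_assoc, mul_inv]

/-- The gradient of the truncated kernels is controlled by that of the Newtonian kernel, uniformly
in the truncation radius. -/
theorem exists_norm_fderiv_scaledTruncFund_le (hd : 3 ≤ dim) :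
    ∃ K, 0 ≤ K ∧ ∀ ε : ℝ, 0 < ε → ∀ y : E, y ≠ 0 →
      ‖fderiv ℝ (scaledTruncFund ε) y‖ ≤ K / ‖y‖ ^ (dim - 1) := by
  have hdim : dim - 2 + 1 = dim - 1 := by omega
  have hcont : ∀ y : E, y ≠ 0 → ContinuousAt (fderiv ℝ newtonFund) y := fun y hy =>
    ((contDiffAt_newtonFund (n := 2) hy).fderiv_right (m := 1) (by norm_num)).continuousAt
  obtain ⟨K₁, hK₁, h₁⟩ := (isHomogeneous_newtonFund.fderiv fun y hy =>
    (contDiffAt_newtonFund (n := 1) hy).differentiableAt (by simp)).exists_bound hcont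
  have hcont' : Continuous (fderiv ℝ (truncFund : E → ℝ)) :=
    contDiff_truncFund.continuous_fderiv (by simp)
  obtain ⟨K₂, h₂⟩ := (isCompact_closedBall (0 : E) 2).exists_bound_of_continuousOn
    hcont'.continuousOn
  have hK₂ : 0 ≤ K₂ := (norm_nonneg _).trans (h₂ 0 (by simp))
  -- Compactness inside the ball of radius `2`, homogeneity outside; the general case is a dilation.
  have key : ∀ y : E, y ≠ 0 →
      ‖fderiv ℝ truncFund y‖ ≤ (K₁ + K₂ * 2 ^ (dim - 1)) / ‖y‖ ^ (dim - 1) := by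
    intro y hy
    have hy' : 0 < ‖y‖ := norm_pos_iff.2 hy
    rcases le_or_gt ‖y‖ 2 with h | h
    · refine (h₂ y (by simpa using h)).trans ?_
      rw [le_div_iff₀ (by positivity)]
      have : K₂ * ‖y‖ ^ (dim - 1) ≤ K₂ * 2 ^ (dim - 1) := by gcongr
      linarith
    · rw [(truncFund_eventuallyEq hd (by linarith)).fderiv_eq]
      refine (h₁ y hy).trans ?_
      rw [hdim]
      gcongr
      have : 0 ≤ K₂ * 2 ^ (dim - 1) := by positivity
      linarith
  refine ⟨K₁ + K₂ * 2 ^ (dim - 1), by positivity, fun ε hε y hy => ?_⟩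
  have h1 : (scaledTruncFund ε : E → ℝ) =
      fun y => (ε ^ (dim - 2))⁻¹ • (truncFund (ε⁻¹ • y)) := rfl
  have hd1 : DifferentiableAt ℝ (fun y : E => truncFund (ε⁻¹ • y)) y :=
    (contDiff_truncFund.comp (contDiff_const_smul _)).differentiable_infty y
  rw [h1, fderiv_fun_const_smul hd1, fderiv_comp_smul, norm_smul, norm_smul, norm_inv, norm_inv,
    norm_pow, Real.norm_of_nonneg hε.le]
  have h := key (ε⁻¹ • y) (smul_ne_zero (by positivity) hy)
  rw [norm_smul, norm_inv, Real.norm_of_nonneg hε.le] at h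
  calc _ ≤ (ε ^ (dim - 2))⁻¹ * (ε⁻¹ * ((K₁ + K₂ * 2 ^ (dim - 1)) / (ε⁻¹ * ‖y‖) ^ (dim - 1))) := by
        gcongr
    _ = _ := by
        rw [← hdim, pow_succ, mul_pow, inv_pow, pow_succ ε]
        field_simp

variable [MeasurableSpace E] [BorelSpace E]

/-- The total mass of the regularized Dirac measure `Δ truncFund`: in polar coordinates the
integrand is the derivative of `2 r^d g'(r²)`, where `g` is the radial profile. -/
theorem integral_laplacian_truncFund (hd : 3 ≤ dim) :
    ∫ y, (Δ (truncFund : E → ℝ)) y =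
      -((dim : ℝ) * (dim - 2) * volume.real (Metric.ball (0 : E) 1)) := by
  have : Nontrivial E := Module.nontrivial_of_finrank_pos (R := ℝ) (by omega)
  set g := truncProfile dim with hg
  set f : ℝ → ℝ := fun r => 4 * r ^ 2 * deriv (deriv g) (r ^ 2) + 2 * dim * deriv g (r ^ 2) with hf
  have hΔ : (Δ (truncFund : E → ℝ)) = fun y => f ‖y‖ := funext laplacian_truncFund
  have hint : Integrable (fun y : E => f ‖y‖) := by
    rw [← hΔ]
    exact contDiff_truncFund.laplacian.continuous.integrable_of_hasCompactSupport
      hasCompactSupport_laplacian_truncFund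
  have hint' := (integrable_fun_norm_addHaar volume).1 hint
  have hg2 : ContDiff ℝ ∞ g := contDiff_truncProfile _
  have hg1 : ContDiff ℝ ∞ (deriv g) := hg2.iterate_deriv 1
  have hderiv : ∀ r ∈ Ici (0 : ℝ), HasDerivAt (fun r => 2 * r ^ dim * deriv g (r ^ 2))
      (r ^ (dim - 1) • f r) r := by
    intro r _
    have h1 := (hg1.differentiable (by simp) (r ^ 2)).hasDerivAt.comp r (hasDerivAt_pow 2 r)
    have h2 := ((hasDerivAt_pow dim r).const_mul 2).mul h1
    refine h2.congr_deriv ?_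
    have : r ^ dim = r ^ (dim - 1) * r := by rw [← pow_succ]; congr 1; omega
    simp only [hf, this, smul_eq_mul, Function.comp]
    push_cast
    ring
  have hlim : Tendsto (fun r => 2 * r ^ dim * deriv g (r ^ 2)) atTop (𝓝 (2 - dim : ℝ)) := by
    refine tendsto_const_nhds.congr' ?_
    filter_upwards [eventually_gt_atTop 1] with r hr
    have hr0 : 0 < r := by linarith
    have hs : 1 < r ^ 2 := one_lt_pow₀ hr two_ne_zero
    have h3 : (r ^ 2) ^ (1 - dim / 2 - 1 : ℝ) = (r ^ dim)⁻¹ := by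
      rw [← Real.rpow_natCast, ← Real.rpow_natCast, ← Real.rpow_mul hr0.le, ← Real.rpow_neg hr0.le]
      congr 1
      push_cast
      ring
    rw [(truncProfile_eventuallyEq dim hs).deriv_eq,
      (deriv_rpow_const_eventuallyEq _ (by positivity)).eq_of_nhds, h3]
    field_simp
  have hI := integral_Ioi_of_hasDerivAt_of_tendsto' hderiv hint' hlim
  rw [hΔ, integral_fun_norm_addHaar volume f, hI]
  simp [show dim ≠ 0 by omega]
  ring

end Laplacian

end Newton

/-! ### Testing the equation with kernels that decay like `‖y‖⁻ᵈ` -/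

section Testing

variable {E : Type*} [NormedAddCommGroup E] [InnerProductSpace ℝ E]

local notation "dim" => Module.finrank ℝ E

theorem norm_inv_smul_eq {R : ℝ} (hR : 0 < R) (y : E) : ‖R⁻¹ • y‖ = ‖y‖ / R := by
  rw [norm_smul, norm_inv, Real.norm_of_nonneg hR.le, inv_mul_eq_div]

variable [FiniteDimensional ℝ E]

/-- A smooth cutoff: `1` on the unit ball and `0` outside the ball of radius `2`. -/
noncomputable def unitCutoff (y : E) : ℝ :=
  (⟨1, 2, one_pos, one_lt_two⟩ : ContDiffBump (0 : E)) y

/-- A smooth cutoff: `1` on the ball of radius `R` and `0` outside the ball of radius `2R`. -/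
noncomputable def cutoff (R : ℝ) (y : E) : ℝ := unitCutoff (R⁻¹ • y)

theorem contDiff_unitCutoff : ContDiff ℝ ∞ (unitCutoff : E → ℝ) :=
  ContDiffBump.contDiff _

theorem contDiff_cutoff (R : ℝ) : ContDiff ℝ ∞ (cutoff R : E → ℝ) :=
  contDiff_unitCutoff.comp (contDiff_const_smul _)

theorem cutoff_nonneg (R : ℝ) (y : E) : 0 ≤ cutoff R y := ContDiffBump.nonneg _

theorem cutoff_le_one (R : ℝ) (y : E) : cutoff R y ≤ 1 := ContDiffBump.le_one _

theorem cutoff_eq_one {R : ℝ} (hR : 0 < R) {y : E} (hy : ‖y‖ ≤ R) : cutoff R y = 1 := by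
  refine ContDiffBump.one_of_mem_closedBall _ ?_
  rw [mem_closedBall_zero_iff, norm_inv_smul_eq hR]
  exact (div_le_one hR).2 hy

theorem cutoff_eq_zero {R : ℝ} (hR : 0 < R) {y : E} (hy : 2 * R ≤ ‖y‖) : cutoff R y = 0 := by
  refine ContDiffBump.zero_of_le_dist _ ?_
  rw [dist_zero_right, norm_inv_smul_eq hR]
  exact (le_div_iff₀ hR).2 hy

theorem hasCompactSupport_cutoff {R : ℝ} (hR : 0 < R) : HasCompactSupport (cutoff R : E → ℝ) :=
  HasCompactSupport.intro (isCompact_closedBall (0 : E) (2 * R)) fun y hy =>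
    cutoff_eq_zero hR (le_of_lt (by simpa using hy))

theorem cutoff_eventuallyEq_const {R : ℝ} (hR : 0 < R) {y : E} (hy : ‖y‖ < R ∨ 2 * R < ‖y‖) :
    ∃ c : ℝ, cutoff R =ᶠ[𝓝 y] fun _ => c := by
  rcases hy with hy | hy
  · refine ⟨1, ?_⟩
    filter_upwards [continuous_norm.continuousAt.eventually (isOpen_Iio.mem_nhds hy)] with z hz
    exact cutoff_eq_one hR (le_of_lt hz)
  · refine ⟨0, ?_⟩
    filter_upwards [continuous_norm.continuousAt.eventually (isOpen_Ioi.mem_nhds hy)] with z hz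
    exact cutoff_eq_zero hR (le_of_lt hz)

theorem dirDeriv_cutoff_eq_zero {R : ℝ} (hR : 0 < R) {y : E} (hy : ‖y‖ < R ∨ 2 * R < ‖y‖)
    (v : E) : dirDeriv v (cutoff R) y = 0 := by
  obtain ⟨c, hc⟩ := cutoff_eventuallyEq_const hR hy
  rw [dirDeriv, hc.fderiv_eq]
  simp

theorem laplacian_cutoff_eq_zero {R : ℝ} (hR : 0 < R) {y : E} (hy : ‖y‖ < R ∨ 2 * R < ‖y‖) :
    (Δ (cutoff R : E → ℝ)) y = 0 := by
  obtain ⟨c, hc⟩ := cutoff_eventuallyEq_const hR hy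
  rw [(InnerProductSpace.laplacian_congr_nhds hc).eq_of_nhds]
  simp

theorem hasCompactSupport_unitCutoff : HasCompactSupport (unitCutoff : E → ℝ) :=
  ContDiffBump.hasCompactSupport _

theorem exists_bound_derivatives_cutoff : ∃ B : ℝ, 0 ≤ B ∧ ∀ R : ℝ, 0 < R → ∀ y : E,
    (∀ i, |dirDeriv (stdOrthonormalBasis ℝ E i) (cutoff R) y| ≤ B / R) ∧
      |(Δ (cutoff R : E → ℝ)) y| ≤ B / R ^ 2 := by
  have hc := hasCompactSupport_unitCutoff (E := E)
  have hs := contDiff_unitCutoff (E := E)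
  obtain ⟨B₁, h₁⟩ := (hs.continuous_fderiv (by simp)).bounded_above_of_compact_support
    (hc.fderiv ℝ)
  obtain ⟨B₂, h₂⟩ := hs.laplacian.continuous.bounded_above_of_compact_support hc.laplacian
  have hB₁ : 0 ≤ B₁ := (norm_nonneg _).trans (h₁ 0)
  refine ⟨max B₁ B₂, hB₁.trans (le_max_left _ _), fun R hR y => ⟨fun i => ?_, ?_⟩⟩
  · have : dirDeriv (stdOrthonormalBasis ℝ E i) (cutoff R) =
        fun y => R⁻¹ * dirDeriv (stdOrthonormalBasis ℝ E i) unitCutoff (R⁻¹ • y) :=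
      dirDeriv_comp_smul _ _ _
    rw [this, abs_mul, abs_of_pos (inv_pos.2 hR), inv_mul_eq_div]
    gcongr
    refine (norm_dirDeriv_le _ _ _).trans ?_
    rw [OrthonormalBasis.norm_eq_one, mul_one]
    exact (h₁ _).trans (le_max_left _ _)
  · have : (Δ (cutoff R : E → ℝ)) = fun y => R⁻¹ ^ 2 * (Δ (unitCutoff : E → ℝ)) (R⁻¹ • y) :=
      laplacian_comp_smul hs _
    rw [this, abs_mul, abs_of_nonneg (by positivity), inv_pow, inv_mul_eq_div]
    gcongr
    exact (h₂ _).trans (le_max_right _ _)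

/-- A smooth function that is harmonic outside a ball and decays like `‖y‖⁻ᵈ` there, along with
its gradient decaying one order faster. This is the decay that makes a pairing with functions of
subquadratic growth insensitive to a cutoff at infinity. -/
structure IsDecayingKernel (H : E → ℝ) (M K : ℝ) : Prop where
  contDiff : ContDiff ℝ ∞ H
  pos : 0 < M
  nonneg : 0 ≤ K
  harmonic : ∀ y, M ≤ ‖y‖ → (Δ H) y = 0
  bound : ∀ y, M ≤ ‖y‖ → |H y| ≤ K / ‖y‖ ^ dim
  bound_fderiv : ∀ y, M ≤ ‖y‖ → ‖fderiv ℝ H y‖ ≤ K / ‖y‖ ^ (dim + 1)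

theorem IsDecayingKernel.hasCompactSupport_laplacian {H : E → ℝ} {M K : ℝ}
    (hH : IsDecayingKernel H M K) : HasCompactSupport (Δ H) :=
  HasCompactSupport.intro (isCompact_closedBall (0 : E) M) fun y hy =>
    hH.harmonic y (le_of_lt (by simpa using hy))

/-- The terms of `Δ (H * cutoff R)` in which the cutoff is differentiated. -/
noncomputable def cutoffError (H : E → ℝ) (R : ℝ) (y : E) : ℝ :=
  H y * (Δ (cutoff R : E → ℝ)) y + 2 * ∑ i, dirDeriv (stdOrthonormalBasis ℝ E i) H y *
    dirDeriv (stdOrthonormalBasis ℝ E i) (cutoff R) y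

theorem cutoffError_eq_zero (H : E → ℝ) {R : ℝ} (hR : 0 < R) {y : E}
    (hy : ‖y‖ < R ∨ 2 * R < ‖y‖) : cutoffError H R y = 0 := by
  simp [cutoffError, laplacian_cutoff_eq_zero hR hy, dirDeriv_cutoff_eq_zero hR hy]

theorem IsDecayingKernel.continuous_cutoffError {H : E → ℝ} {M K : ℝ}
    (hH : IsDecayingKernel H M K) (R : ℝ) : Continuous (cutoffError H R) := by
  refine (hH.contDiff.continuous.mul (contDiff_cutoff R).laplacian.continuous).add
    (continuous_const.mul (continuous_finsetSum _ fun i _ => ?_))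
  exact (hH.contDiff.dirDeriv _).continuous.mul ((contDiff_cutoff R).dirDeriv _).continuous

theorem IsDecayingKernel.exists_bound_cutoffError {H : E → ℝ} {M K : ℝ}
    (hH : IsDecayingKernel H M K) :
    ∃ A : ℝ, 0 ≤ A ∧ ∀ R, M ≤ R → ∀ y, |cutoffError H R y| ≤ A / R ^ (dim + 2) := by
  obtain ⟨B, hB, hη⟩ := exists_bound_derivatives_cutoff (E := E)
  refine ⟨K * B + 2 * (dim * (K * B)), by have := hH.nonneg; positivity, fun R hMR y => ?_⟩
  have hR : 0 < R := hH.pos.trans_le hMR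
  have hK := hH.nonneg
  by_cases hy : ‖y‖ < R
  · rw [cutoffError_eq_zero H hR (Or.inl hy), abs_zero]; positivity
  push Not at hy
  have h1 : |H y * (Δ (cutoff R : E → ℝ)) y| ≤ K * B / R ^ (dim + 2) := by
    rw [abs_mul, pow_add, mul_div_mul_comm]
    gcongr
    · exact (hH.bound y (hMR.trans hy)).trans (by gcongr)
    · exact (hη R hR y).2
  have h2 : ∀ i, |dirDeriv (stdOrthonormalBasis ℝ E i) H y *
      dirDeriv (stdOrthonormalBasis ℝ E i) (cutoff R) y| ≤ K * B / R ^ (dim + 2) := by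
    intro i
    rw [abs_mul, show dim + 2 = dim + 1 + 1 by ring, pow_succ, mul_div_mul_comm]
    gcongr
    · refine (norm_dirDeriv_le _ _ _).trans ?_
      rw [OrthonormalBasis.norm_eq_one, mul_one]
      exact (hH.bound_fderiv y (hMR.trans hy)).trans (by gcongr)
    · exact (hη R hR y).1 i
  calc |cutoffError H R y| ≤ K * B / R ^ (dim + 2) + 2 * ∑ i : Fin dim, K * B / R ^ (dim + 2) := by
        refine (abs_add_le _ _).trans (add_le_add h1 ?_)
        rw [abs_mul, abs_two]
        gcongr
        exact (Finset.abs_sum_le_sum_abs _ _).trans (Finset.sum_le_sum fun i _ => h2 i)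
    _ = _ := by
        simp only [Finset.sum_const, Finset.card_univ, Fintype.card_fin, nsmul_eq_mul]
        ring

theorem IsDecayingKernel.laplacian_mul_cutoff {H : E → ℝ} {M K : ℝ}
    (hH : IsDecayingKernel H M K) {R : ℝ} (hMR : M ≤ R) (y : E) :
    (Δ fun z => H z * cutoff R z) y = (Δ H) y + cutoffError H R y := by
  rw [laplacian_mul hH.contDiff (contDiff_cutoff R), cutoffError]
  -- The cutoff differs from `1` only where `H` is harmonic.
  have : (Δ H) y * cutoff R y = (Δ H) y := by
    rcases le_total ‖y‖ R with h | h
    · rw [cutoff_eq_one (hH.pos.trans_le hMR) h, mul_one]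
    · rw [hH.harmonic y (hMR.trans h), zero_mul]
  rw [this]
  ring

variable [MeasurableSpace E] [BorelSpace E]

/-- `w` solves `Δw = -χ_C` in the sense of distributions, grows slower than quadratically, and
vanishes to first order at the origin. -/
structure IsSubquadraticPotential (C : Set E) (w : E → ℝ) : Prop where
  continuous : Continuous w
  growth : ∀ δ > 0, ∃ R, ∀ y, R ≤ ‖y‖ → |w y| ≤ δ * ‖y‖ ^ 2
  equation : ∀ φ : E → ℝ, ContDiff ℝ ∞ φ → HasCompactSupport φ →
    ∫ y, w y * (Δ φ) y = -∫ y in C, φ y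
  map_zero : w 0 = 0
  hasFDerivAt_zero : HasFDerivAt w (0 : E →L[ℝ] ℝ) 0

/-- Testing the equation `Δw = -χ_C` with a kernel that is not compactly supported: the error
caused by the cutoff is `o(R²) · O(R^{-d-2}) · O(R^d)`. -/
theorem IsSubquadraticPotential.tendsto_setIntegral_mul_cutoff {C : Set E} {w : E → ℝ}
    (hw : IsSubquadraticPotential C w) {H : E → ℝ} {M K : ℝ} (hH : IsDecayingKernel H M K) :
    Tendsto (fun R => ∫ y in C, H y * cutoff R y) atTop (𝓝 (-∫ y, w y * (Δ H) y)) := by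
  obtain ⟨A, hA, hE⟩ := hH.exists_bound_cutoffError
  have hcE : ∀ R, M ≤ R → HasCompactSupport (cutoffError H R) := fun R hR =>
    HasCompactSupport.intro (isCompact_closedBall (0 : E) (2 * R)) fun y hy =>
      cutoffError_eq_zero H (hH.pos.trans_le hR) (Or.inr (by simpa using hy))
  have hsplit : ∀ R, M ≤ R → ∫ y in C, H y * cutoff R y =
      (-∫ y, w y * (Δ H) y) - ∫ y, w y * cutoffError H R y := by
    intro R hR
    have h := hw.equation _ (hH.contDiff.mul (contDiff_cutoff R))
      (hasCompactSupport_cutoff (hH.pos.trans_le hR)).mul_left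
    simp only [hH.laplacian_mul_cutoff hR, mul_add] at h
    rw [integral_add] at h
    · linarith
    · exact (hw.continuous.mul hH.contDiff.laplacian.continuous).integrable_of_hasCompactSupport
        hH.hasCompactSupport_laplacian.mul_left
    · exact (hw.continuous.mul (hH.continuous_cutoffError R)).integrable_of_hasCompactSupport
        (hcE R hR).mul_left
  suffices h : Tendsto (fun R => ∫ y, w y * cutoffError H R y) atTop (𝓝 0) by
    have h' := (tendsto_const_nhds (x := -∫ y, w y * (Δ H) y)).sub h
    rw [sub_zero] at h'
    refine h'.congr' ?_
    filter_upwards [eventually_ge_atTop M] with R hR using (hsplit R hR).symm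
  rw [Metric.tendsto_atTop]
  intro ε hε
  set V := volume.real (Metric.ball (0 : E) 1)
  have hV : 0 ≤ V := measureReal_nonneg
  -- The error is at most `(4 δ A / R ^ d) * ((2 R) ^ d * V)`; this `δ` makes it less than `ε`.
  set δ := ε / (2 * (4 * A * 2 ^ dim * V + 1)) with hδ
  have hδ0 : 0 < δ := by positivity
  obtain ⟨R₀, hR₀⟩ := hw.growth δ hδ0
  refine ⟨max M R₀, fun R hR => ?_⟩
  have hMR : M ≤ R := (le_max_left _ _).trans hR
  have hR0 : 0 < R := hH.pos.trans_le hMR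
  have hpt : ∀ y, ‖w y * cutoffError H R y‖ ≤ 4 * δ * A / R ^ dim := by
    intro y
    by_cases hy : ‖y‖ < R ∨ 2 * R < ‖y‖
    · rw [cutoffError_eq_zero H hR0 hy, mul_zero, norm_zero]; positivity
    push Not at hy
    have h1 := hR₀ y (((le_max_right _ _).trans hR).trans hy.1)
    have h2 := hE R hMR y
    rw [norm_mul, Real.norm_eq_abs, Real.norm_eq_abs]
    calc |w y| * |cutoffError H R y| ≤ (δ * (2 * R) ^ 2) * (A / R ^ (dim + 2)) := by
          gcongr
          exact h1.trans (by gcongr; exact hy.2)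
      _ = _ := by rw [pow_add]; field_simp; ring
  have hset : ∫ y, w y * cutoffError H R y =
      ∫ y in Metric.closedBall (0 : E) (2 * R), w y * cutoffError H R y := by
    refine (setIntegral_eq_integral_of_forall_compl_eq_zero fun y hy => ?_).symm
    rw [cutoffError_eq_zero H hR0 (Or.inr (by simpa using hy)), mul_zero]
  have hvol : volume.real (Metric.closedBall (0 : E) (2 * R)) = (2 * R) ^ dim * V :=
    Measure.addHaar_real_closedBall _ _ (by positivity)
  rw [dist_zero_right, hset]
  have := norm_setIntegral_le_of_norm_le_const (μ := volume)
    (s := Metric.closedBall (0 : E) (2 * R)) (measure_closedBall_lt_top) (fun y _ => hpt y)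
  refine this.trans_lt ?_
  rw [hvol]
  calc 4 * δ * A / R ^ dim * ((2 * R) ^ dim * V) = δ * (4 * A * 2 ^ dim * V) := by
        rw [mul_pow]; field_simp
    _ ≤ δ * (4 * A * 2 ^ dim * V + 1) := by gcongr; linarith
    _ = ε / 2 := by rw [hδ]; field_simp
    _ < ε := by linarith

end Testing

/-! ### Decay of the renormalized kernels -/

section Kernels

-- The norm on trilinear maps, where third derivatives live, is found only at this search depth.
set_option maxSynthPendingDepth 3

variable {E : Type*} [NormedAddCommGroup E] [InnerProductSpace ℝ E]

local notation "dim" => Module.finrank ℝ E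

theorem dirDeriv_congr_nhds {f g : E → ℝ} {y : E} (h : f =ᶠ[𝓝 y] g) (v : E) :
    dirDeriv v f =ᶠ[𝓝 y] dirDeriv v g := by
  filter_upwards [h.eventuallyEq_nhds] with z hz
  rw [dirDeriv, dirDeriv, hz.fderiv_eq]

theorem dirDeriv_zero (v : E) : dirDeriv v (fun _ : E => (0 : ℝ)) = fun _ => 0 := by
  ext y
  simp [dirDeriv]

theorem dirDeriv_comp_sub (f : E → ℝ) (a v : E) :
    dirDeriv v (fun y => f (y - a)) = fun y => dirDeriv v f (y - a) := by
  ext y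
  rw [dirDeriv, fderiv_comp_sub, dirDeriv]

theorem ContDiff.comp_sub_const {f : E → ℝ} (hf : ContDiff ℝ ∞ f) (a : E) :
    ContDiff ℝ ∞ fun y => f (y - a) :=
  hf.comp (contDiff_id.sub contDiff_const)

theorem fderiv_fderiv_newtonFund_symm {y : E} (hy : y ≠ 0) (v w : E) :
    fderiv ℝ (fderiv ℝ (newtonFund : E → ℝ)) y v w =
      fderiv ℝ (fderiv ℝ (newtonFund : E → ℝ)) y w v :=
  ((contDiffAt_newtonFund (n := 2) hy).isSymmSndFDerivAt (by simp)).eq v w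

theorem contDiffAt_fderiv_newtonFund {y : E} (hy : y ≠ 0) :
    ContDiffAt ℝ ∞ (fderiv ℝ (newtonFund : E → ℝ)) y :=
  (contDiffAt_newtonFund (n := ∞) hy).fderiv_right (m := ∞) (by simp)

theorem contDiffAt_fderiv_fderiv_newtonFund {y : E} (hy : y ≠ 0) :
    ContDiffAt ℝ ∞ (fderiv ℝ (fderiv ℝ (newtonFund : E → ℝ))) y :=
  (contDiffAt_fderiv_newtonFund hy).fderiv_right (m := ∞) (by simp)

theorem contDiffAt_fderiv_fderiv_fderiv_newtonFund {y : E} (hy : y ≠ 0) :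
    ContDiffAt ℝ ∞ (fderiv ℝ (fderiv ℝ (fderiv ℝ (newtonFund : E → ℝ)))) y :=
  (contDiffAt_fderiv_fderiv_newtonFund hy).fderiv_right (m := ∞) (by simp)

theorem isHomogeneous_fderiv_fderiv_newtonFund (hd : 3 ≤ dim) :
    IsHomogeneousOfNegDegree dim (fderiv ℝ (fderiv ℝ (newtonFund : E → ℝ))) := by
  have h1 := (isHomogeneous_newtonFund (E := E)).fderiv fun y hy =>
    (contDiffAt_newtonFund (n := ∞) hy).differentiableAt (by simp)
  have h2 := h1.fderiv fun y hy => (contDiffAt_fderiv_newtonFund hy).differentiableAt (by simp)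
  rwa [show dim - 2 + 1 + 1 = dim by omega] at h2

/-- The Newtonian kernel minus its first-order Taylor polynomial in `x` at `x = 0`. -/
noncomputable def renormalizedKernel (x y : E) : ℝ :=
  newtonFund (y - x) - newtonFund y + dirDeriv x newtonFund y

/-- The renormalized kernel built from the smooth truncations of the Newtonian kernel. -/
noncomputable def truncKernel (ε : ℝ) (x y : E) : ℝ :=
  scaledTruncFund ε (y - x) - scaledTruncFund ε y + dirDeriv x (scaledTruncFund ε) y

theorem contDiff_truncKernel (ε : ℝ) (x : E) : ContDiff ℝ ∞ (truncKernel ε x) :=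
  ((((contDiff_scaledTruncFund ε).comp_sub_const x).sub (contDiff_scaledTruncFund ε)).add
    ((contDiff_scaledTruncFund ε).dirDeriv x))

theorem truncKernel_eventuallyEq (hd : 3 ≤ dim) {ε : ℝ} (hε : 0 < ε) {x y : E} (hy : ε < ‖y‖)
    (hyx : ε < ‖y - x‖) : truncKernel ε x =ᶠ[𝓝 y] renormalizedKernel x := by
  have h := scaledTruncFund_eventuallyEq hd hε hy
  have hc : ContinuousAt (fun z => z - x) y := by fun_prop
  filter_upwards [h, dirDeriv_congr_nhds h x,
    hc.eventually (scaledTruncFund_eventuallyEq hd hε hyx)] with z h1 h2 h3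
  rw [truncKernel, renormalizedKernel, h1, h2, h3]

section FiniteDimensional

variable [FiniteDimensional ℝ E]

theorem exists_bounds_newtonFund (hd : 3 ≤ dim) : ∃ K : ℝ, 0 ≤ K ∧ ∀ y : E, y ≠ 0 →
    ‖fderiv ℝ (fderiv ℝ (newtonFund : E → ℝ)) y‖ ≤ K / ‖y‖ ^ dim ∧
      ‖fderiv ℝ (fderiv ℝ (fderiv ℝ (newtonFund : E → ℝ))) y‖ ≤ K / ‖y‖ ^ (dim + 1) := by
  have h2 := isHomogeneous_fderiv_fderiv_newtonFund hd
  have h3 := h2.fderiv fun y hy =>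
    (contDiffAt_fderiv_fderiv_newtonFund hy).differentiableAt (by simp)
  obtain ⟨K₁, hK₁, hb₁⟩ := h2.exists_bound fun y hy =>
    (contDiffAt_fderiv_fderiv_newtonFund hy).continuousAt
  obtain ⟨K₂, hK₂, hb₂⟩ := h3.exists_bound fun y hy =>
    (contDiffAt_fderiv_fderiv_fderiv_newtonFund hy).continuousAt
  refine ⟨K₁ + K₂, by positivity, fun y hy => ⟨(hb₁ y hy).trans ?_, (hb₂ y hy).trans ?_⟩⟩
  · gcongr; linarith
  · gcongr; linarith

theorem laplacian_scaledTruncFund_eventuallyEq_zero (hd : 3 ≤ dim) {ε : ℝ} (hε : 0 < ε) {y : E}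
    (hy : ε < ‖y‖) : Δ (scaledTruncFund ε : E → ℝ) =ᶠ[𝓝 y] fun _ => 0 := by
  filter_upwards [continuous_norm.continuousAt.eventually (isOpen_Ioi.mem_nhds hy)] with z hz
  simp only [laplacian_scaledTruncFund hd]
  rw [laplacian_truncFund_eq_zero, mul_zero]
  rw [norm_inv_smul_eq hε]
  exact (one_lt_div hε).2 hz

theorem laplacian_comp_sub {f : E → ℝ} (hf : ContDiff ℝ ∞ f) (a : E) :
    (Δ fun y => f (y - a)) = fun y => (Δ f) (y - a) := by
  rw [laplacian_eq_sum_dirDeriv (stdOrthonormalBasis ℝ E) hf,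
    laplacian_eq_sum_dirDeriv (stdOrthonormalBasis ℝ E) (hf.comp_sub_const a)]
  simp only [dirDeriv_comp_sub]

theorem laplacian_truncKernel (ε : ℝ) (x y : E) : (Δ (truncKernel ε x)) y =
    (Δ (scaledTruncFund ε : E → ℝ)) (y - x) - (Δ (scaledTruncFund ε : E → ℝ)) y +
      dirDeriv x (Δ (scaledTruncFund ε : E → ℝ)) y := by
  have hs := contDiff_scaledTruncFund (E := E) ε
  have h0 := contDiff_infty.1 hs 2
  have h1 := contDiff_infty.1 (hs.comp_sub_const x) 2
  have h2 := contDiff_infty.1 (hs.dirDeriv x) 2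
  have hsub : ContDiffAt ℝ 2 ((fun y => scaledTruncFund ε (y - x)) - scaledTruncFund ε) y :=
    h1.contDiffAt.sub h0.contDiffAt
  have : truncKernel ε x = ((fun y => scaledTruncFund ε (y - x)) - scaledTruncFund ε) +
    dirDeriv x (scaledTruncFund ε) := rfl
  rw [this, hsub.laplacian_add h2.contDiffAt,
    h1.contDiffAt.laplacian_sub h0.contDiffAt, laplacian_comp_sub hs, laplacian_dirDeriv hs]

/-- The kernel is the first-order Taylor remainder of `newtonFund` at `y`, and its gradient is the
Taylor remainder of the gradient of `newtonFund`; hence the decay `‖y‖⁻ᵈ`, respectively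
`‖y‖⁻ᵈ⁻¹`, of the next derivative. -/
theorem renormalizedKernel_bounds (hd : 3 ≤ dim) : ∃ K : ℝ, 0 ≤ K ∧ ∀ x y : E, y ≠ 0 →
    2 * ‖x‖ < ‖y‖ → |renormalizedKernel x y| ≤ K * ‖x‖ ^ 2 / ‖y‖ ^ dim ∧
      ‖fderiv ℝ (renormalizedKernel x) y‖ ≤ K * ‖x‖ ^ 2 / ‖y‖ ^ (dim + 1) := by
  obtain ⟨K, hK, hb⟩ := exists_bounds_newtonFund (E := E) hd
  refine ⟨K * 2 ^ (dim + 1), by positivity, fun x y hy hxy => ?_⟩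
  have hy' : 0 < ‖y‖ := norm_pos_iff.2 hy
  -- A convex set that contains `y` and `y - x` and stays away from the singularity.
  set s := Metric.ball y (‖y‖ / 2) with hs
  have hsn : ∀ z ∈ s, ‖y‖ / 2 ≤ ‖z‖ := fun z hz => by
    have h1 : ‖z - y‖ < ‖y‖ / 2 := by simpa [hs, dist_eq_norm] using hz
    have h2 := norm_sub_norm_le y z
    rw [norm_sub_rev] at h2
    linarith
  have hs0 : ∀ z ∈ s, z ≠ 0 := fun z hz => by
    have := hsn z hz
    exact norm_pos_iff.1 (by linarith)
  have hys : y ∈ s := Metric.mem_ball_self (by positivity)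
  have hyx : y - x ∈ s := by simp [hs]; linarith
  have t1 := norm_taylor_remainder_le (convex_ball y (‖y‖ / 2)) (f := newtonFund)
    (K := K * 2 ^ (dim + 1) / ‖y‖ ^ dim) (fun z hz => contDiffAt_newtonFund (hs0 z hz))
    (fun z hz => by
      refine (hb z (hs0 z hz)).1.trans ?_
      calc K / ‖z‖ ^ dim ≤ K / (‖y‖ / 2) ^ dim := by gcongr; exact hsn z hz
        _ = K * 2 ^ dim / ‖y‖ ^ dim := by rw [div_pow]; field_simp
        _ ≤ _ := by gcongr; norm_num; omega) hys hyx
  have t2 := norm_taylor_remainder_le (convex_ball y (‖y‖ / 2)) (f := fderiv ℝ newtonFund)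
    (K := K * 2 ^ (dim + 1) / ‖y‖ ^ (dim + 1))
    (fun z hz => contDiffAt_infty.1 (contDiffAt_fderiv_newtonFund (hs0 z hz)) 2)
    (fun z hz => by
      refine (hb z (hs0 z hz)).2.trans ?_
      calc K / ‖z‖ ^ (dim + 1) ≤ K / (‖y‖ / 2) ^ (dim + 1) := by gcongr; exact hsn z hz
        _ = _ := by rw [div_pow]; field_simp) hys hyx
  have hfd : fderiv ℝ (renormalizedKernel x) y = fderiv ℝ newtonFund (y - x) -
      fderiv ℝ newtonFund y + fderiv ℝ (fderiv ℝ newtonFund) y x := by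
    have d1 : HasFDerivAt (fun z => newtonFund (z - x)) (fderiv ℝ newtonFund (y - x)) y :=
      (hasFDerivAt_comp_sub x).2
        ((contDiffAt_newtonFund (n := 1) (hs0 _ hyx)).differentiableAt (by simp)).hasFDerivAt
    have d2 : HasFDerivAt newtonFund (fderiv ℝ newtonFund y) y :=
      ((contDiffAt_newtonFund (n := 1) hy).differentiableAt (by simp)).hasFDerivAt
    have d3 : HasFDerivAt (dirDeriv x newtonFund) (fderiv ℝ (dirDeriv x newtonFund) y) y :=
      (((contDiffAt_fderiv_newtonFund hy).differentiableAt (by simp)).clm_apply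
        (differentiableAt_const x)).hasFDerivAt
    have d4 : HasFDerivAt (renormalizedKernel x) _ y := (d1.sub d2).add d3
    rw [d4.fderiv]
    congr 1
    ext v
    rw [fderiv_dirDeriv (contDiffAt_newtonFund hy), fderiv_fderiv_newtonFund_symm hy]
  rw [hfd, renormalizedKernel, dirDeriv, ← Real.norm_eq_abs]
  exact ⟨t1.trans (le_of_eq (by ring)), t2.trans (le_of_eq (by ring))⟩

/-- Far out, the truncated kernels decay like `‖y‖⁻ᵈ`, uniformly in the truncation radius. -/
theorem exists_isDecayingKernel_truncKernel (hd : 3 ≤ dim) (x : E) : ∃ K : ℝ,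
    ∀ ε ∈ Ioc (0 : ℝ) 1, IsDecayingKernel (truncKernel ε x) (2 * ‖x‖ + 2) K := by
  obtain ⟨K, hK, hb⟩ := renormalizedKernel_bounds (E := E) hd
  refine ⟨K * ‖x‖ ^ 2, fun ε hε => ?_⟩
  have hfar : ∀ y : E, 2 * ‖x‖ + 2 ≤ ‖y‖ → ε < ‖y‖ ∧ ε < ‖y - x‖ := fun y hy => by
    have := norm_sub_norm_le y x
    have := norm_nonneg x
    have := hε.2
    constructor <;> linarith
  have heq : ∀ y : E, 2 * ‖x‖ + 2 ≤ ‖y‖ → truncKernel ε x =ᶠ[𝓝 y] renormalizedKernel x :=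
    fun y hy => truncKernel_eventuallyEq hd hε.1 (hfar y hy).1 (hfar y hy).2
  have hne : ∀ y : E, 2 * ‖x‖ + 2 ≤ ‖y‖ → y ≠ 0 ∧ 2 * ‖x‖ < ‖y‖ := fun y hy => by
    have := norm_nonneg x
    exact ⟨norm_pos_iff.1 (by linarith), by linarith⟩
  refine ⟨contDiff_truncKernel ε x, by positivity, by positivity, fun y hy => ?_, fun y hy => ?_,
    fun y hy => ?_⟩
  · have h1 := laplacian_scaledTruncFund_eventuallyEq_zero hd hε.1 (hfar y hy).1
    have h2 := laplacian_scaledTruncFund_eventuallyEq_zero hd hε.1 (hfar y hy).2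
    rw [laplacian_truncKernel, h1.eq_of_nhds, h2.eq_of_nhds,
      (dirDeriv_congr_nhds h1 x).eq_of_nhds, dirDeriv_zero]
    norm_num
  · rw [(heq y hy).eq_of_nhds]
    exact (hb x y (hne y hy).1 (hne y hy).2).1
  · rw [(heq y hy).fderiv_eq]
    exact (hb x y (hne y hy).1 (hne y hy).2).2

/-- The second derivative of the truncated Newtonian kernel in a fixed direction decays like
`‖y‖⁻ᵈ` and is harmonic far out, being a derivative of a harmonic function there. -/
theorem exists_isDecayingKernel_dirDeriv_dirDeriv (hd : 3 ≤ dim) (v : E) : ∃ K : ℝ,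
    IsDecayingKernel (dirDeriv v (dirDeriv v (truncFund : E → ℝ))) 2 K := by
  obtain ⟨K, hK, hb⟩ := exists_bounds_newtonFund (E := E) hd
  have heq : ∀ y : E, 2 ≤ ‖y‖ → dirDeriv v (dirDeriv v (truncFund : E → ℝ)) =ᶠ[𝓝 y]
      fun z => fderiv ℝ (fderiv ℝ newtonFund) z v v := fun y hy => by
    have h1 := dirDeriv_congr_nhds (dirDeriv_congr_nhds (truncFund_eventuallyEq hd
      (show 1 < ‖y‖ by linarith)) v) v
    have hy0 : y ≠ 0 := norm_pos_iff.1 (by linarith)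
    filter_upwards [h1, isOpen_ne.mem_nhds hy0] with z hz hz0
    rw [hz, dirDeriv, fderiv_dirDeriv (contDiffAt_newtonFund hz0)]
  refine ⟨K * ‖v‖ ^ 2, (contDiff_truncFund.dirDeriv v).dirDeriv v, two_pos, by positivity,
    fun y hy => ?_, fun y hy => ?_, fun y hy => ?_⟩
  · have h0 : Δ (truncFund : E → ℝ) =ᶠ[𝓝 y] fun _ => 0 := by
      have hy1 : 1 < ‖y‖ := by linarith
      filter_upwards [continuous_norm.continuousAt.eventually (isOpen_Ioi.mem_nhds hy1)] with z hz
      exact laplacian_truncFund_eq_zero hz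
    rw [laplacian_dirDeriv (contDiff_truncFund.dirDeriv v), laplacian_dirDeriv contDiff_truncFund,
      (dirDeriv_congr_nhds (dirDeriv_congr_nhds h0 v) v).eq_of_nhds]
    simp [dirDeriv_zero]
  · have hy0 : y ≠ 0 := norm_pos_iff.1 (by linarith)
    rw [(heq y hy).eq_of_nhds, ← Real.norm_eq_abs]
    refine (ContinuousLinearMap.le_opNorm₂ _ v v).trans ?_
    calc _ ≤ K / ‖y‖ ^ dim * ‖v‖ * ‖v‖ := by gcongr; exact (hb y hy0).1
      _ = _ := by ring
  · have hy0 : y ≠ 0 := norm_pos_iff.1 (by linarith)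
    have hd3 := ((contDiffAt_fderiv_fderiv_newtonFund hy0).differentiableAt (by simp)).hasFDerivAt
    have hd4 := (hd3.clm_apply (hasFDerivAt_const v y)).clm_apply (hasFDerivAt_const v y)
    rw [(heq y hy).fderiv_eq, hd4.fderiv]
    refine ContinuousLinearMap.opNorm_le_bound _ (by positivity) fun a => ?_
    simp only [ContinuousLinearMap.comp_zero, zero_add, ContinuousLinearMap.flip_apply]
    refine (ContinuousLinearMap.le_opNorm₂ _ v v).trans ?_
    calc _ ≤ K / ‖y‖ ^ (dim + 1) * ‖a‖ * ‖v‖ * ‖v‖ := by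
          gcongr
          refine (ContinuousLinearMap.le_opNorm _ _).trans ?_
          gcongr
          exact (hb y hy0).2
      _ = _ := by ring

end FiniteDimensional

end Kernels

/-! ### Integrability at infinity and the representation formula -/

section Potential

variable {E : Type*} [NormedAddCommGroup E] [InnerProductSpace ℝ E]

local notation "dim" => Module.finrank ℝ E

theorem eventually_truncKernel_eq (hd : 3 ≤ dim) {x y : E} (hy : y ≠ 0) (hyx : y ≠ x) :
    ∀ᶠ ε in 𝓝[>] (0 : ℝ), truncKernel ε x y = renormalizedKernel x y := by
  have h1 : 0 < ‖y‖ := norm_pos_iff.2 hy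
  have h2 : 0 < ‖y - x‖ := norm_pos_iff.2 (sub_ne_zero.2 hyx)
  filter_upwards [Ioo_mem_nhdsGT (lt_min h1 h2)] with ε hε
  exact (truncKernel_eventuallyEq hd hε.1 (hε.2.trans_le (min_le_left _ _))
    (hε.2.trans_le (min_le_right _ _))).eq_of_nhds

variable [FiniteDimensional ℝ E] [MeasurableSpace E] [BorelSpace E]

theorem integrableOn_inv_norm_pow_ball {k : ℕ} (hk : k < dim) (r : ℝ) :
    IntegrableOn (fun y : E => 1 / ‖y‖ ^ k) (Metric.ball 0 r) := by
  have : Nontrivial E := Module.nontrivial_of_finrank_pos (R := ℝ) (by omega)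
  refine (integrableOn_fun_norm_addHaar volume (f := fun t : ℝ => 1 / t ^ k)).2 ?_
  have h : IntegrableOn (fun t : ℝ => t ^ (dim - 1 - k)) (Ioo 0 r) :=
    ((continuous_pow _).integrableOn_Icc (a := 0) (b := r)).mono_set Ioo_subset_Icc_self
  refine h.congr_fun (fun t ht => ?_) measurableSet_Ioo
  have ht0 : t ≠ 0 := ht.1.ne'
  have : t ^ (dim - 1) = t ^ (dim - 1 - k) * t ^ k := by rw [← pow_add]; congr 1; omega
  simp only [this, smul_eq_mul]
  field_simp

theorem integrableOn_inv_norm_sub_pow_ball {k : ℕ} (hk : k < dim) (x : E) (r : ℝ) :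
    IntegrableOn (fun y : E => 1 / ‖y - x‖ ^ k) (Metric.ball 0 r) := by
  have h := (integrable_indicator_iff measurableSet_ball).2
    (integrableOn_inv_norm_pow_ball (E := E) hk (r + ‖x‖))
  refine ((h.comp_sub_right x).integrableOn (s := Metric.ball 0 r)).congr_fun (fun y hy => ?_)
    measurableSet_ball
  have hy' : ‖y‖ < r := by simpa using hy
  refine indicator_of_mem ?_ _
  rw [mem_ball_zero_iff]
  linarith [norm_sub_le y x]

theorem integrableOn_inv_norm_pow_closedBall_diff (k : ℕ) {r : ℝ} (hr : 0 < r) (R : ℝ) (C : Set E) :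
    IntegrableOn (fun y : E => 1 / ‖y‖ ^ k) ((C ∩ Metric.closedBall 0 R) \ Metric.ball 0 r) := by
  have h1 : IntegrableOn (fun y : E => 1 / ‖y‖ ^ k)
      (Metric.closedBall (0 : E) R \ Metric.ball 0 r) := by
    refine Measure.integrableOn_of_bounded (M := 1 / r ^ k) ?_
      (by fun_prop : Measurable fun y : E => 1 / ‖y‖ ^ k).aestronglyMeasurable ?_
    · exact ((measure_mono sdiff_subset).trans_lt measure_closedBall_lt_top).ne
    · filter_upwards [ae_restrict_mem (measurableSet_closedBall.diff measurableSet_ball)] with y hy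
      have hy2 : r ≤ ‖y‖ := by simpa using hy.2
      rw [Real.norm_of_nonneg (by positivity)]
      gcongr
  exact h1.mono_set (sdiff_subset_sdiff_left inter_subset_right)

/-- If the second derivative of the Newtonian kernel in some direction is comparable to `‖y‖⁻ᵈ` on
the far part of `C`, then testing `Δw = -χ_C` with it shows that `‖y‖⁻ᵈ` is integrable there. -/
theorem IsSubquadraticPotential.integrableOn_inv_norm_pow (hd : 3 ≤ dim) {C : Set E} {w : E → ℝ}
    (hw : IsSubquadraticPotential C w) (hC : MeasurableSet C) {v : E} {c M₀ : ℝ} (hc : 0 < c)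
    (hpos : ∀ y ∈ C, M₀ ≤ ‖y‖ → c / ‖y‖ ^ dim ≤ dirDeriv v (dirDeriv v newtonFund) y) :
    IntegrableOn (fun y : E => 1 / ‖y‖ ^ dim) (C \ Metric.ball 0 1) := by
  obtain ⟨K, hH⟩ := exists_isDecayingKernel_dirDeriv_dirDeriv hd v
  set H := dirDeriv v (dirDeriv v (truncFund : E → ℝ)) with hHdef
  set M := max M₀ 2 with hM
  set S := C \ Metric.ball (0 : E) M with hS
  have hSm : MeasurableSet S := hC.diff measurableSet_ball
  have hSM : ∀ y ∈ S, M ≤ ‖y‖ := fun y hy => by simpa using hy.2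
  have hlow : ∀ y ∈ S, c / ‖y‖ ^ dim ≤ H y := fun y hy => by
    have h2 : 2 ≤ ‖y‖ := (le_max_right _ _).trans (hSM y hy)
    rw [hHdef, (dirDeriv_congr_nhds (dirDeriv_congr_nhds (truncFund_eventuallyEq hd
      (show 1 < ‖y‖ by linarith)) v) v).eq_of_nhds]
    exact hpos y hy.1 ((le_max_left _ _).trans (hSM y hy))
  have hlim := hw.tendsto_setIntegral_mul_cutoff hH
  set L := -∫ y, w y * (Δ H) y
  -- `H` has no sign on the ball of radius `M`; the contribution of that part is at least `-J`.
  set J := ∫ y in C ∩ Metric.ball (0 : E) M, |H y|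
  have hHball : IntegrableOn (fun y => |H y|) (C ∩ Metric.ball (0 : E) M) :=
    ((hH.contDiff.continuous.abs.continuousOn.integrableOn_compact
      (isCompact_closedBall (0 : E) M)).mono_set Metric.ball_subset_closedBall).mono_set
      inter_subset_right
  have hfar : IntegrableOn (fun y : E => 1 / ‖y‖ ^ dim) S := by
    have hcov : AECover (volume.restrict S) atTop fun R : ℝ => Metric.ball (0 : E) R :=
      aecover_ball tendsto_id
    refine hcov.integrable_of_integral_bounded_of_nonneg_ae (c⁻¹ * (L + 1 + J)) (fun R => ?_)
      (Eventually.of_forall fun y => by positivity) ?_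
    · rw [IntegrableOn, Measure.restrict_restrict measurableSet_ball]
      refine (integrableOn_inv_norm_pow_closedBall_diff dim (two_pos.trans_le (le_max_right M₀ 2))
        R C).mono_set fun y hy => ⟨⟨hy.2.1, Metric.ball_subset_closedBall hy.1⟩, hy.2.2⟩
    · filter_upwards [hlim.eventually (Iio_mem_nhds (show L < L + 1 by linarith)),
        eventually_gt_atTop 0] with R hR hR0
      have hint : Integrable fun y => H y * cutoff R y :=
        (hH.contDiff.continuous.mul
          (contDiff_cutoff R).continuous).integrable_of_hasCompactSupport
          (hasCompactSupport_cutoff hR0).mul_left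
      have hsplit : ∫ y in C, H y * cutoff R y =
          (∫ y in C ∩ Metric.ball (0 : E) M, H y * cutoff R y) + ∫ y in S, H y * cutoff R y :=
        (integral_inter_add_sdiff measurableSet_ball hint.integrableOn).symm
      have hJ : -J ≤ ∫ y in C ∩ Metric.ball (0 : E) M, H y * cutoff R y := by
        rw [← integral_neg]
        refine integral_mono hHball.neg hint.integrableOn fun y => ?_
        have h1 : |H y * cutoff R y| ≤ |H y| := by
          rw [abs_mul, abs_of_nonneg (cutoff_nonneg R y)]
          exact mul_le_of_le_one_right (abs_nonneg _) (cutoff_le_one R y)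
        exact (neg_le_neg h1).trans (neg_abs_le _)
      have hmain : c * ∫ y in Metric.ball (0 : E) R, 1 / ‖y‖ ^ dim ∂(volume.restrict S) ≤
          ∫ y in S, H y * cutoff R y := by
        rw [← integral_const_mul, ← integral_indicator measurableSet_ball]
        refine setIntegral_mono_on ?_ hint.integrableOn hSm fun y hy => ?_
        · rw [IntegrableOn, integrable_indicator_iff measurableSet_ball, IntegrableOn,
            Measure.restrict_restrict measurableSet_ball]
          refine Integrable.const_mul ?_ c
          refine (integrableOn_inv_norm_pow_closedBall_diff dim
            (two_pos.trans_le (le_max_right M₀ 2)) R C).mono_set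
            fun y hy => ⟨⟨hy.2.1, Metric.ball_subset_closedBall hy.1⟩, hy.2.2⟩
        · by_cases hyR : y ∈ Metric.ball (0 : E) R
          · rw [indicator_of_mem hyR, cutoff_eq_one hR0 (le_of_lt (by simpa using hyR)), mul_one,
              mul_one_div]
            exact hlow y hy
          · rw [indicator_of_notMem hyR]
            have : 0 ≤ c / ‖y‖ ^ dim := by positivity
            exact mul_nonneg (this.trans (hlow y hy)) (cutoff_nonneg R y)
      rw [inv_mul_eq_div, le_div_iff₀ hc, mul_comm]
      have hR' : ∫ y in C, H y * cutoff R y < L + 1 := hR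
      linarith
  refine (hfar.union (integrableOn_inv_norm_pow_closedBall_diff dim one_pos M C)).mono_set
    fun y hy => ?_
  by_cases hyM : y ∈ Metric.ball (0 : E) M
  · exact Or.inr ⟨⟨hy.1, Metric.ball_subset_closedBall hyM⟩, hy.2⟩
  · exact Or.inl ⟨hy.1, hyM⟩

/-- The truncated kernels have a common integrable majorant on every set on which `‖y‖⁻ᵈ` is
integrable at infinity. -/
theorem exists_integrableOn_bound_truncKernel (hd : 3 ≤ dim) {C : Set E}
    (hint : IntegrableOn (fun y : E => 1 / ‖y‖ ^ dim) (C \ Metric.ball 0 1)) (x : E) :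
    ∃ g : E → ℝ, IntegrableOn g C ∧
      ∀ ε ∈ Ioc (0 : ℝ) 1, ∀ y : E, y ≠ 0 → |truncKernel ε x y| ≤ g y := by
  obtain ⟨K, hK⟩ := exists_isDecayingKernel_truncKernel hd x
  obtain ⟨K₁, hK₁, hb⟩ := exists_norm_fderiv_scaledTruncFund_le (E := E) hd
  set M := 2 * ‖x‖ + 2 with hM
  have hM1 : 1 ≤ M := by have := norm_nonneg x; linarith
  set g₁ : E → ℝ := fun y => 1 / ‖y - x‖ ^ (dim - 2) + 1 / ‖y‖ ^ (dim - 2) +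
    K₁ * ‖x‖ * (1 / ‖y‖ ^ (dim - 1)) with hg₁
  set g₂ : E → ℝ := fun y => K * (1 / ‖y‖ ^ dim) with hg₂
  refine ⟨(Metric.ball 0 M).indicator g₁ + (Metric.ball 0 M)ᶜ.indicator g₂, ?_, ?_⟩
  · have h1 : IntegrableOn g₁ (Metric.ball 0 M) :=
      ((integrableOn_inv_norm_sub_pow_ball (by omega) x M).add
        (integrableOn_inv_norm_pow_ball (by omega) M)).add
        ((integrableOn_inv_norm_pow_ball (by omega) M).const_mul _)
    have h2 : IntegrableOn g₂ (C \ Metric.ball 0 M) :=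
      (hint.mono_set (sdiff_subset_sdiff_right (Metric.ball_subset_ball hM1))).const_mul K
    refine IntegrableOn.add ((integrable_indicator_iff measurableSet_ball).2 h1).integrableOn ?_
    rw [IntegrableOn, integrable_indicator_iff measurableSet_ball.compl, IntegrableOn,
      Measure.restrict_restrict measurableSet_ball.compl, inter_comm]
    exact h2
  · intro ε hε y hy
    by_cases hyM : y ∈ Metric.ball (0 : E) M
    · rw [Pi.add_apply, indicator_of_mem hyM, indicator_of_notMem (by simpa using hyM), add_zero]
      refine (abs_add_le _ _).trans (add_le_add ((abs_sub _ _).trans (add_le_add ?_ ?_)) ?_)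
      · exact abs_scaledTruncFund_le hd hε.1 _
      · exact abs_scaledTruncFund_le hd hε.1 _
      · refine (norm_dirDeriv_le _ _ _).trans ?_
        calc _ ≤ K₁ / ‖y‖ ^ (dim - 1) * ‖x‖ := by gcongr; exact hb ε hε.1 y hy
          _ = _ := by ring
    · rw [Pi.add_apply, indicator_of_notMem hyM, indicator_of_mem hyM, zero_add]
      exact ((hK ε hε).bound y (by simpa using hyM)).trans (le_of_eq (by rw [hg₂]; ring))

theorem ae_ne_ne (hd : 3 ≤ dim) (x : E) : ∀ᵐ y : E, y ≠ 0 ∧ y ≠ x := by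
  have : Nontrivial E := Module.nontrivial_of_finrank_pos (R := ℝ) (by omega)
  filter_upwards [Measure.ae_ne volume (0 : E), Measure.ae_ne volume x] with y h1 h2
    using ⟨h1, h2⟩

/-- Removing the truncation: the renormalized kernel is integrable on `C`, and its integral is the
limit of those of the truncated kernels. -/
theorem tendsto_setIntegral_truncKernel (hd : 3 ≤ dim) {C : Set E}
    (hint : IntegrableOn (fun y : E => 1 / ‖y‖ ^ dim) (C \ Metric.ball 0 1)) (x : E) :
    IntegrableOn (renormalizedKernel x) C ∧
    Tendsto (fun ε => ∫ y in C, truncKernel ε x y) (𝓝[>] 0)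
      (𝓝 (∫ y in C, renormalizedKernel x y)) := by
  obtain ⟨g, hg, hb⟩ := exists_integrableOn_bound_truncKernel hd hint x
  have hne := ae_restrict_of_ae (s := C) (ae_ne_ne hd x)
  have hmeas : ∀ ε, AEStronglyMeasurable (truncKernel ε x) (volume.restrict C) := fun ε =>
    (contDiff_truncKernel ε x).continuous.aestronglyMeasurable
  have hlim : ∀ᵐ y ∂(volume.restrict C),
      Tendsto (fun ε => truncKernel ε x y) (𝓝[>] 0) (𝓝 (renormalizedKernel x y)) := by
    filter_upwards [hne] with y hy
    refine tendsto_const_nhds.congr' ?_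
    filter_upwards [eventually_truncKernel_eq hd hy.1 hy.2] with ε hε using hε.symm
  have hε1 : ∀ᶠ ε in 𝓝[>] (0 : ℝ), ε ∈ Ioc (0 : ℝ) 1 := Ioc_mem_nhdsGT one_pos
  refine ⟨Integrable.mono' hg (aestronglyMeasurable_of_tendsto_ae _ hmeas hlim) ?_,
    tendsto_integral_filter_of_dominated_convergence g (Eventually.of_forall hmeas) ?_ hg hlim⟩
  · filter_upwards [hne] with y hy
    obtain ⟨ε, h1, h2⟩ := (hε1.and (eventually_truncKernel_eq hd hy.1 hy.2)).exists
    rw [← h2]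
    exact hb ε h1 y hy.1
  · filter_upwards [hε1] with ε hε
    filter_upwards [hne] with y hy using hb ε hε y hy.1

/-- `Δw = -χ_C` tested with a truncated kernel; integrability of `‖y‖⁻ᵈ` at infinity on `C` allows
the cutoff to be removed. -/
theorem IsSubquadraticPotential.setIntegral_truncKernel (hd : 3 ≤ dim) {C : Set E} {w : E → ℝ}
    (hw : IsSubquadraticPotential C w)
    (hint : IntegrableOn (fun y : E => 1 / ‖y‖ ^ dim) (C \ Metric.ball 0 1)) (x : E) {ε : ℝ}
    (hε : ε ∈ Ioc (0 : ℝ) 1) :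
    ∫ y in C, truncKernel ε x y = -∫ y, w y * (Δ (truncKernel ε x)) y := by
  obtain ⟨g, hg, hb⟩ := exists_integrableOn_bound_truncKernel hd hint x
  obtain ⟨K, hK⟩ := exists_isDecayingKernel_truncKernel hd x
  refine tendsto_nhds_unique ?_ (hw.tendsto_setIntegral_mul_cutoff (hK ε hε))
  refine tendsto_integral_filter_of_dominated_convergence g (Eventually.of_forall fun R => ?_)
    (Eventually.of_forall fun R => ?_) hg (Eventually.of_forall fun y => ?_)
  · exact ((contDiff_truncKernel ε x).continuous.mul
      (contDiff_cutoff R).continuous).aestronglyMeasurable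
  · filter_upwards [ae_restrict_of_ae (ae_ne_ne hd x)] with y hy
    rw [norm_mul, Real.norm_of_nonneg (cutoff_nonneg R y)]
    exact (mul_le_of_le_one_right (norm_nonneg _) (cutoff_le_one R y)).trans (hb ε hε y hy.1)
  · refine tendsto_const_nhds.congr' ?_
    filter_upwards [eventually_gt_atTop 0, eventually_ge_atTop ‖y‖] with R hR hyR
    rw [cutoff_eq_one hR hyR, mul_one]

/-- Pairing with the `L¹`-normalized dilation of `ρ`. -/
theorem integral_mul_comp_inv_smul (F ρ : E → ℝ) {ε : ℝ} (hε : 0 < ε) :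
    ∫ y, F y * ((ε ^ dim)⁻¹ * ρ (ε⁻¹ • y)) = ∫ z, F (ε • z) * ρ z := by
  have h := Measure.integral_comp_inv_smul_of_nonneg volume
    (fun z => F (ε • z) * ρ z) hε.le
  simp only [smul_smul, mul_inv_cancel₀ hε.ne', one_smul] at h
  rw [show (fun y => F y * ((ε ^ dim)⁻¹ * ρ (ε⁻¹ • y))) =
    fun y => (ε ^ dim)⁻¹ * (F y * ρ (ε⁻¹ • y)) by ext; ring, integral_const_mul, h, smul_eq_mul]
  field_simp

theorem tendsto_integral_mul_dilation {w ρ : E → ℝ} (hw : Continuous w) (hρ : Continuous ρ)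
    (hc : HasCompactSupport ρ) (x : E) :
    Tendsto (fun ε : ℝ => ∫ z, w (ε • z + x) * ρ z) (𝓝[>] 0) (𝓝 (w x * ∫ z, ρ z)) := by
  have h1 : Continuous fun ε : ℝ => ∫ z in tsupport ρ, w (ε • z + x) * ρ z :=
    continuous_parametric_integral_of_continuous (f := fun (ε : ℝ) z => w (ε • z + x) * ρ z)
      (by fun_prop) hc
  have h2 : ∀ ε : ℝ, ∫ z in tsupport ρ, w (ε • z + x) * ρ z = ∫ z, w (ε • z + x) * ρ z :=
    fun ε => setIntegral_eq_integral_of_forall_compl_eq_zero fun z hz => by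
      rw [image_eq_zero_of_notMem_tsupport hz, mul_zero]
  have h3 := h1.tendsto 0
  simp only [h2, zero_smul, zero_add, integral_const_mul] at h3
  have h4 : ∫ z in tsupport ρ, ρ z = ∫ z, ρ z :=
    setIntegral_eq_integral_of_forall_compl_eq_zero fun z hz =>
      image_eq_zero_of_notMem_tsupport hz
  rw [h4] at h3
  exact h3.mono_left nhdsWithin_le_nhds

/-- Pairing a function that vanishes to first order at the origin with dilations of `ρ` gains a
factor `o(ε)`. -/
theorem tendsto_integral_mul_dilation_of_hasFDerivAt_zero {w ρ : E → ℝ} (h0 : w 0 = 0)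
    (hw : HasFDerivAt w (0 : E →L[ℝ] ℝ) 0) (hρ : Continuous ρ) (hc : HasCompactSupport ρ) :
    Tendsto (fun ε : ℝ => ε⁻¹ * ∫ z, w (ε • z) * ρ z) (𝓝[>] 0) (𝓝 0) := by
  obtain ⟨B, hB⟩ := hc.isCompact.isBounded.exists_norm_le
  set B' := max B 0 + 1
  have hB' : ∀ z ∈ tsupport ρ, ‖z‖ ≤ B' := fun z hz => by
    have := hB z hz
    have := le_max_left B 0
    linarith
  have hB0 : 0 < B' := by have := le_max_right B 0; positivity
  have hρi : Integrable fun z => |ρ z| := (hρ.integrable_of_hasCompactSupport hc).abs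
  set J := ∫ z, |ρ z|
  have hJ : 0 ≤ J := integral_nonneg fun z => abs_nonneg _
  rw [Metric.tendsto_nhds]
  intro δ hδ
  set η := δ / (2 * (B' * J + 1)) with hη
  have hη0 : 0 < η := by positivity
  have hlo := hasFDerivAt_iff_isLittleO_nhds_zero.1 hw
  have hlo' := hlo.bound hη0
  simp only [zero_add, h0, sub_zero, _root_.zero_apply] at hlo'
  obtain ⟨r, hr, hball⟩ := Metric.eventually_nhds_iff.1 hlo'
  filter_upwards [Ioo_mem_nhdsGT (show 0 < r / B' by positivity)] with ε hε
  have hε0 : 0 < ε := hε.1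
  have hpt : ∀ z, ‖w (ε • z) * ρ z‖ ≤ η * (ε * B') * |ρ z| := by
    intro z
    by_cases hz : z ∈ tsupport ρ
    · have hn : ‖ε • z‖ ≤ ε * B' := by
        rw [norm_smul, Real.norm_of_nonneg hε0.le]
        gcongr
        exact hB' z hz
      have hlt : ε * B' < r := (lt_div_iff₀ hB0).1 hε.2
      have h1 := hball (show dist (ε • z) 0 < r by rw [dist_zero_right]; linarith)
      rw [norm_mul, Real.norm_eq_abs (ρ z)]
      gcongr
      exact h1.trans (by gcongr)
    · rw [image_eq_zero_of_notMem_tsupport hz]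
      simp
  have h2 := norm_integral_le_of_norm_le (hρi.const_mul (η * (ε * B'))) (Eventually.of_forall hpt)
  rw [integral_const_mul] at h2
  rw [dist_zero_right, norm_mul, norm_inv, Real.norm_of_nonneg hε0.le]
  calc ε⁻¹ * ‖∫ z, w (ε • z) * ρ z‖ ≤ ε⁻¹ * (η * (ε * B') * J) := by gcongr
    _ = η * (B' * J) := by field_simp
    _ ≤ η * (B' * J + 1) := by gcongr; linarith
    _ = δ / 2 := by rw [hη]; field_simp
    _ < δ := by linarith

/-- As the truncation radius shrinks, `Δ (truncKernel ε x)` tends to a multiple of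
`δ_x - δ_0 + x · ∇δ_0`, and the two terms at the origin do not see `w`. -/
theorem IsSubquadraticPotential.tendsto_integral_mul_laplacian_truncKernel (hd : 3 ≤ dim)
    {C : Set E} {w : E → ℝ} (hw : IsSubquadraticPotential C w) (x : E) :
    Tendsto (fun ε => ∫ y, w y * (Δ (truncKernel ε x)) y) (𝓝[>] 0)
      (𝓝 (w x * ∫ y, (Δ (truncFund : E → ℝ)) y)) := by
  set ρ : E → ℝ := Δ (truncFund : E → ℝ) with hρ
  have hρs : ContDiff ℝ ∞ ρ := contDiff_truncFund.laplacian
  have hρc : HasCompactSupport ρ := hasCompactSupport_laplacian_truncFund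
  have t1 := tendsto_integral_mul_dilation hw.continuous hρs.continuous hρc x
  have t2 := tendsto_integral_mul_dilation hw.continuous hρs.continuous hρc 0
  have t3 := tendsto_integral_mul_dilation_of_hasFDerivAt_zero hw.map_zero hw.hasFDerivAt_zero
    (hρs.dirDeriv x).continuous (hρc.dirDeriv x)
  have t := (t1.sub t2).add t3
  rw [hw.map_zero, zero_mul, sub_zero, add_zero] at t
  refine t.congr' ?_
  filter_upwards [self_mem_nhdsWithin] with ε hε
  have hε0 : 0 < ε := hε
  have hψ : Δ (scaledTruncFund ε : E → ℝ) = fun y => (ε ^ dim)⁻¹ * ρ (ε⁻¹ • y) :=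
    laplacian_scaledTruncFund hd ε
  have hψs : ContDiff ℝ ∞ (Δ (scaledTruncFund ε : E → ℝ)) := (contDiff_scaledTruncFund ε).laplacian
  have hψc : HasCompactSupport (Δ (scaledTruncFund ε : E → ℝ)) :=
    HasCompactSupport.intro (isCompact_closedBall (0 : E) ε) fun y hy =>
      (laplacian_scaledTruncFund_eventuallyEq_zero hd hε0 (by simpa using hy)).eq_of_nhds
  have hdψ : dirDeriv x (Δ (scaledTruncFund ε : E → ℝ)) =
      fun y => ε⁻¹ * ((ε ^ dim)⁻¹ * dirDeriv x ρ (ε⁻¹ • y)) := by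
    rw [hψ]
    ext y
    have hdiff : DifferentiableAt ℝ (fun y : E => ρ (ε⁻¹ • y)) y :=
      (hρs.comp (contDiff_const_smul ε⁻¹)).differentiable_infty y
    have h1 := congrFun (dirDeriv_comp_smul ρ ε⁻¹ x) y
    rw [dirDeriv] at h1
    rw [dirDeriv, fderiv_const_mul hdiff, _root_.smul_apply, h1, smul_eq_mul]
    ring
  have i1 : Integrable fun y => w y * (Δ (scaledTruncFund ε : E → ℝ)) (y - x) := by
    have hc' : HasCompactSupport fun y => (Δ (scaledTruncFund ε : E → ℝ)) (y - x) :=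
      hψc.comp_homeomorph (Homeomorph.subRight x)
    exact (hw.continuous.mul (hψs.comp_sub_const x).continuous).integrable_of_hasCompactSupport
      hc'.mul_left
  have i2 : Integrable fun y => w y * (Δ (scaledTruncFund ε : E → ℝ)) y :=
    (hw.continuous.mul hψs.continuous).integrable_of_hasCompactSupport hψc.mul_left
  have i3 : Integrable fun y => w y * dirDeriv x (Δ (scaledTruncFund ε : E → ℝ)) y :=
    (hw.continuous.mul (hψs.dirDeriv x).continuous).integrable_of_hasCompactSupport
      (hψc.dirDeriv x).mul_left
  simp only [laplacian_truncKernel, mul_add, mul_sub]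
  rw [integral_add (by exact i1.sub i2) i3, integral_sub i1 i2]
  congr 1
  · congr 1
    · simp only [hψ]
      rw [← integral_add_right_eq_self
        (fun y => w y * ((ε ^ dim)⁻¹ * ρ (ε⁻¹ • (y - x)))) x]
      simp only [add_sub_cancel_right]
      exact (integral_mul_comp_inv_smul (fun y => w (y + x)) ρ hε0).symm
    · simp only [hψ, add_zero]
      exact (integral_mul_comp_inv_smul w ρ hε0).symm
  · simp only [hdψ]
    rw [← integral_mul_comp_inv_smul w _ hε0, ← integral_const_mul]
    congr 1
    ext y
    ring

/-- The representation formula for subquadratic solutions of `Δw = -χ_C`. -/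
theorem IsSubquadraticPotential.setIntegral_renormalizedKernel (hd : 3 ≤ dim) {C : Set E}
    {w : E → ℝ} (hw : IsSubquadraticPotential C w)
    (hint : IntegrableOn (fun y : E => 1 / ‖y‖ ^ dim) (C \ Metric.ball 0 1)) (x : E) :
    ∫ y in C, renormalizedKernel x y =
      (dim : ℝ) * (dim - 2) * volume.real (Metric.ball (0 : E) 1) * w x := by
  have h1 := (tendsto_setIntegral_truncKernel hd hint x).2
  have h2 := (hw.tendsto_integral_mul_laplacian_truncKernel hd x).neg
  rw [integral_laplacian_truncFund hd] at h2
  refine (tendsto_nhds_unique h1 (h2.congr' ?_)).trans (by ring)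
  filter_upwards [Ioc_mem_nhdsGT one_pos] with ε hε
  exact (hw.setIntegral_truncKernel hd hint x hε).symm

end Potential

/-! ### The blow-down limit and the coincidence set -/

section Quadratic

variable {n : ℕ}

theorem horizontal_add_smul (x v : EuclideanSpace ℝ (Fin (n + 1))) (t : ℝ) :
    (fun i : Fin n => (x + t • v) i.castSucc) =
      (fun i : Fin n => x i.castSucc) + t • fun i : Fin n => v i.castSucc := by
  ext i
  simp

theorem contDiff_horizontalQuadratic (Q : Matrix (Fin n) (Fin n) ℝ) :
    ContDiff ℝ ∞ (horizontalQuadratic Q) := by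
  unfold horizontalQuadratic
  simp only [dotProduct, Matrix.mulVec]
  fun_prop

theorem horizontalQuadratic_smul (Q : Matrix (Fin n) (Fin n) ℝ) (t : ℝ)
    (x : EuclideanSpace ℝ (Fin (n + 1))) :
    horizontalQuadratic Q (t • x) = t ^ 2 * horizontalQuadratic Q x := by
  have h := horizontal_add_smul 0 x t
  rw [zero_add] at h
  rw [horizontalQuadratic, h, horizontalQuadratic]
  have h0 : (fun i : Fin n => (0 : EuclideanSpace ℝ (Fin (n + 1))) i.castSucc) = 0 := by
    ext i; simp
  rw [h0, zero_add, Matrix.mulVec_smul, smul_dotProduct, dotProduct_smul, smul_eq_mul, smul_eq_mul]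
  ring

theorem horizontalQuadratic_zero (Q : Matrix (Fin n) (Fin n) ℝ) :
    horizontalQuadratic Q 0 = 0 := by
  simpa using horizontalQuadratic_smul Q 0 0

theorem horizontalQuadratic_nonneg {Q : Matrix (Fin n) (Fin n) ℝ} (hQ : Q.PosDef)
    (x : EuclideanSpace ℝ (Fin (n + 1))) : 0 ≤ horizontalQuadratic Q x := by
  have h := hQ.posSemidef.dotProduct_mulVec_nonneg fun i : Fin n => x i.castSucc
  rw [star_trivial] at h
  rw [horizontalQuadratic]
  linarith

theorem eq_zero_of_horizontalQuadratic_eq_zero {Q : Matrix (Fin n) (Fin n) ℝ} (hQ : Q.PosDef)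
    {x : EuclideanSpace ℝ (Fin (n + 1))} (hx : horizontalQuadratic Q x = 0) (i : Fin n) :
    x i.castSucc = 0 := by
  by_contra hi
  have hne : (fun i : Fin n => x i.castSucc) ≠ 0 := fun h => hi (congrFun h i)
  have h := hQ.dotProduct_mulVec_pos hne
  rw [star_trivial] at h
  rw [horizontalQuadratic] at hx
  linarith

theorem dirDeriv_eq_of_quadratic_along {E : Type*} [NormedAddCommGroup E] [InnerProductSpace ℝ E]
    {f : E → ℝ} {x v : E} {a b : ℝ} (hf : DifferentiableAt ℝ f x)
    (h : ∀ t : ℝ, f (x + t • v) = f x + t * a + t ^ 2 * b) : dirDeriv v f x = a := by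
  have h1 : HasDerivAt (fun t : ℝ => f (x + t • v)) (fderiv ℝ f x v) 0 :=
    hf.hasFDerivAt.hasLineDerivAt v
  have h2 : HasDerivAt (fun t : ℝ => f x + t * a + t ^ 2 * b) (1 * a + 2 * 0 * b) 0 := by
    have := (((hasDerivAt_id (0 : ℝ)).mul_const a).const_add (f x)).add
      ((hasDerivAt_pow 2 (0 : ℝ)).mul_const b)
    simpa using! this
  simp only [h] at h1
  have := h1.unique h2
  rw [dirDeriv, this]
  ring

theorem dirDeriv_dirDeriv_horizontalQuadratic (Q : Matrix (Fin n) (Fin n) ℝ)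
    (v x : EuclideanSpace ℝ (Fin (n + 1))) :
    dirDeriv v (dirDeriv v (horizontalQuadratic Q)) x = 2 * horizontalQuadratic Q v := by
  have hs := contDiff_horizontalQuadratic Q
  set r : EuclideanSpace ℝ (Fin (n + 1)) → Fin n → ℝ := fun x i => x i.castSucc with hr
  have h1 : dirDeriv v (horizontalQuadratic Q) =
      fun x => (1 / 2) * (r x ⬝ᵥ (Q *ᵥ r v) + r v ⬝ᵥ (Q *ᵥ r x)) := by
    ext x
    refine dirDeriv_eq_of_quadratic_along (b := horizontalQuadratic Q v)
      (hs.differentiable_infty x) fun t => ?_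
    simp only [horizontalQuadratic, horizontal_add_smul, Matrix.mulVec_add, Matrix.mulVec_smul,
      add_dotProduct, dotProduct_add, smul_dotProduct, dotProduct_smul, smul_eq_mul, hr]
    ring
  refine dirDeriv_eq_of_quadratic_along (b := 0)
    ((hs.dirDeriv v).differentiable_infty x) fun t => ?_
  rw [h1]
  have h2 : r (x + t • v) = r x + t • r v := horizontal_add_smul x v t
  have h3 : horizontalQuadratic Q v = (1 / 2) * (r v ⬝ᵥ (Q *ᵥ r v)) := rfl
  simp only [h2, h3, Matrix.mulVec_add, Matrix.mulVec_smul,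
      add_dotProduct, dotProduct_add, smul_dotProduct, dotProduct_smul, smul_eq_mul]
  ring

theorem laplacian_horizontalQuadratic (Q : Matrix (Fin n) (Fin n) ℝ)
    (x : EuclideanSpace ℝ (Fin (n + 1))) : (Δ (horizontalQuadratic Q)) x = Q.trace := by
  rw [laplacian_eq_sum_dirDeriv (EuclideanSpace.basisFun (Fin (n + 1)) ℝ)
    (contDiff_horizontalQuadratic Q)]
  simp only [dirDeriv_dirDeriv_horizontalQuadratic, EuclideanSpace.basisFun_apply,
    horizontalQuadratic]
  rw [Fin.sum_univ_castSucc]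
  have h1 : ∀ i : Fin n, (fun j : Fin n =>
      (EuclideanSpace.single i.castSucc (1 : ℝ) : EuclideanSpace ℝ (Fin (n + 1))) j.castSucc) =
      Pi.single i 1 := fun i => by
    ext j
    simp [Pi.single_apply]
  have h2 : (fun j : Fin n =>
      (EuclideanSpace.single (Fin.last n) (1 : ℝ) : EuclideanSpace ℝ (Fin (n + 1))) j.castSucc) =
      0 := by
    ext j
    simp [Fin.castSucc_ne_last]
  simp only [h1, h2]
  simp [Matrix.trace]

end Quadratic

section Obstacle

variable {n : ℕ} {u : EuclideanSpace ℝ (Fin (n + 1)) → ℝ}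

local notation "𝔼" => EuclideanSpace ℝ (Fin (n + 1))

theorem IsBlowDownLimit.unique {u p q : 𝔼 → ℝ} (hp : IsBlowDownLimit u p)
    (hq : IsBlowDownLimit u q) : p = q := by
  ext x
  refine eq_of_forall_dist_le fun ε hε => ?_
  have hα : (1 / 2 : ℝ) ∈ Ioo (0 : ℝ) 1 := by norm_num
  have hR : 0 < ‖x‖ + 1 := by positivity
  have hx : x ∈ Metric.closedBall (0 : 𝔼) (‖x‖ + 1) := by simp
  obtain ⟨r, h1, h2⟩ := ((hp _ hα _ hR (ε / 2) (by positivity)).and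
    (hq _ hα _ hR (ε / 2) (by positivity))).exists
  have h1' := abs_le.1 (h1.1 x hx)
  have h2' := abs_le.1 (h2.1 x hx)
  rw [Real.dist_eq, abs_le]
  constructor <;> linarith

/-- Uniform convergence of the blow-downs on the unit ball, read at `y / ‖y‖` with `r = ‖y‖`. -/
theorem IsBlowDownLimit.exists_abs_sub_le {Q : Matrix (Fin n) (Fin n) ℝ}
    (h : IsBlowDownLimit u (horizontalQuadratic Q)) {δ : ℝ} (hδ : 0 < δ) :
    ∃ R, 0 < R ∧ ∀ y, R ≤ ‖y‖ → |u y - horizontalQuadratic Q y| ≤ δ * ‖y‖ ^ 2 := by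
  obtain ⟨R, hR⟩ := eventually_atTop.1 (h (1 / 2) (by norm_num) 1 one_pos δ hδ)
  refine ⟨max R 1, by positivity, fun y hy => ?_⟩
  have hy0 : 0 < ‖y‖ := one_pos.trans_le ((le_max_right _ _).trans hy)
  have h1 := (hR ‖y‖ ((le_max_left _ _).trans hy)).1 (‖y‖⁻¹ • y)
    (by simp [norm_inv_smul_eq hy0, div_self hy0.ne'])
  simp only [smul_smul, mul_inv_cancel₀ hy0.ne', one_smul, horizontalQuadratic_smul] at h1
  have h2 : u y - horizontalQuadratic Q y =
      (u y / ‖y‖ ^ 2 - ‖y‖⁻¹ ^ 2 * horizontalQuadratic Q y) * ‖y‖ ^ 2 := by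
    field_simp
  rw [h2, abs_mul, abs_of_pos (pow_pos hy0 2)]
  gcongr

theorem IsGlobalObstacleSolution.isClosed_coincidenceSet (hu : IsGlobalObstacleSolution u) :
    IsClosed (coincidenceSet u) :=
  isClosed_eq hu.differentiable.continuous continuous_const

theorem hasFDerivAt_zero_of_nonneg {f : 𝔼 → ℝ} (hf : Differentiable ℝ f) (h : ∀ x, 0 ≤ f x)
    (h0 : f 0 = 0) : HasFDerivAt f (0 : 𝔼 →L[ℝ] ℝ) 0 := by
  have hmin : IsLocalMin f 0 := Eventually.of_forall fun x => by rw [h0]; exact h x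
  have := (hf 0).hasFDerivAt
  rwa [hmin.fderiv_eq_zero] at this

theorem IsGlobalObstacleSolution.isSubquadraticPotential (hu : IsGlobalObstacleSolution u)
    (h0 : 0 ∈ coincidenceSet u) {Q : Matrix (Fin n) (Fin n) ℝ} (hQ : Q.PosDef)
    (htr : Q.trace = 1) (hlim : IsBlowDownLimit u (horizontalQuadratic Q)) :
    IsSubquadraticPotential (coincidenceSet u) fun y => u y - horizontalQuadratic Q y where
  continuous := hu.differentiable.continuous.sub (contDiff_horizontalQuadratic Q).continuous
  growth δ hδ := by
    obtain ⟨R, _, hR⟩ := hlim.exists_abs_sub_le hδ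
    exact ⟨R, hR⟩
  equation φ hφ hc := by
    have hΔ := hφ.laplacian.continuous
    have hΔc : HasCompactSupport (Δ φ) := hc.laplacian
    have hu' := (hu.differentiable.continuous.mul hΔ).integrable_of_hasCompactSupport
      (μ := volume) hΔc.mul_left
    have hq' := ((contDiff_horizontalQuadratic Q).continuous.mul
      hΔ).integrable_of_hasCompactSupport (μ := volume) hΔc.mul_left
    have hφi : Integrable φ := hφ.continuous.integrable_of_hasCompactSupport hc
    have hset : {x | 0 < u x} = (coincidenceSet u)ᶜ := by
      ext x
      exact (hu.nonneg x).lt_iff_ne'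
    have hsplit := integral_add_compl hu.isClosed_coincidenceSet.measurableSet hφi
    have hgreen := integral_mul_laplacian_comm (contDiff_horizontalQuadratic Q) hφ hc
    simp only [laplacian_horizontalQuadratic, htr, one_mul] at hgreen
    simp only [sub_mul]
    rw [integral_sub (by exact hu') (by exact hq'), hu.equation φ hφ hc, hgreen, hset]
    linarith
  map_zero := by
    have : u 0 = 0 := h0
    rw [this, horizontalQuadratic_zero, sub_zero]
  hasFDerivAt_zero := by
    have h1 := hasFDerivAt_zero_of_nonneg hu.differentiable hu.nonneg h0
    have h2 := hasFDerivAt_zero_of_nonneg (contDiff_horizontalQuadratic Q).differentiable_infty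
      (horizontalQuadratic_nonneg hQ) (horizontalQuadratic_zero Q)
    have := h1.sub h2
    rwa [sub_zero] at this

/-- A zero of the blow-down limit on the unit sphere is `± e_N`, so away from the two poles the
limit is bounded below. -/
theorem exists_pos_le_horizontalQuadratic {Q : Matrix (Fin n) (Fin n) ℝ} (hQ : Q.PosDef) :
    ∃ m > 0, ∀ z : 𝔼, ‖z‖ = 1 → z (Fin.last n) ^ 2 ≤ 1 / 2 → m ≤ horizontalQuadratic Q z := by
  set S : Set 𝔼 := Metric.sphere 0 1 ∩ {z | z (Fin.last n) ^ 2 ≤ 1 / 2} with hS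
  have hSc : IsCompact S := (isCompact_sphere _ _).inter_right
    (isClosed_le (by fun_prop) continuous_const)
  rcases S.eq_empty_or_nonempty with hE | hne
  · refine ⟨1, one_pos, fun z h1 h2 => ?_⟩
    have : z ∈ S := ⟨by simpa using h1, h2⟩
    rw [hE] at this
    exact this.elim
  obtain ⟨z₀, hz₀, hmin⟩ := hSc.exists_isMinOn hne
    (contDiff_horizontalQuadratic Q).continuous.continuousOn
  refine ⟨horizontalQuadratic Q z₀, ?_, fun z h1 h2 => hmin ⟨by simpa using h1, h2⟩⟩
  refine (horizontalQuadratic_nonneg hQ z₀).lt_of_ne' fun h => ?_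
  have h1 : ‖z₀‖ ^ 2 = 1 := by
    have : ‖z₀‖ = 1 := by simpa using hz₀.1
    rw [this]; norm_num
  rw [EuclideanSpace.norm_sq_eq, Fin.sum_univ_castSucc] at h1
  simp only [eq_zero_of_horizontalQuadratic_eq_zero hQ h, Real.norm_eq_abs, sq_abs] at h1
  have h2 : z₀ (Fin.last n) ^ 2 ≤ 1 / 2 := hz₀.2
  simp at h1
  rcases h1 with h1 | h1 <;> rw [h1] at h2 <;> norm_num at h2

/-- The coincidence set is asymptotically close to the `x_N`-axis, where the second vertical
derivative of the Newtonian kernel is positive. -/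
theorem IsBlowDownLimit.exists_le_dirDeriv_newtonFund (hN : 3 ≤ n + 1)
    {Q : Matrix (Fin n) (Fin n) ℝ} (hQ : Q.PosDef)
    (hlim : IsBlowDownLimit u (horizontalQuadratic Q)) :
    ∃ M, ∀ y ∈ coincidenceSet u, M ≤ ‖y‖ →
      (1 / 2) / ‖y‖ ^ Module.finrank ℝ 𝔼 ≤ dirDeriv (EuclideanSpace.single (Fin.last n) 1)
        (dirDeriv (EuclideanSpace.single (Fin.last n) 1) newtonFund) y := by
  have hd : 3 ≤ Module.finrank ℝ 𝔼 := by simpa using hN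
  obtain ⟨m, hm, hlow⟩ := exists_pos_le_horizontalQuadratic hQ
  obtain ⟨R, hR, hclose⟩ := hlim.exists_abs_sub_le (half_pos hm)
  refine ⟨R, fun y hy hRy => ?_⟩
  set e : 𝔼 := EuclideanSpace.single (Fin.last n) 1
  have hy0 : 0 < ‖y‖ := hR.trans_le hRy
  set z := ‖y‖⁻¹ • y with hz
  have hz1 : ‖z‖ = 1 := by rw [hz, norm_inv_smul_eq hy0, div_self hy0.ne']
  have hyz : y = ‖y‖ • z := by rw [hz, smul_smul, mul_inv_cancel₀ hy0.ne', one_smul]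
  have hz0 : z ≠ 0 := by rw [← norm_ne_zero_iff, hz1]; norm_num
  -- Otherwise `z` is away from the poles, where `Q` bounds `u y` from below, although `u y = 0`.
  have hzN : 1 / 2 < z (Fin.last n) ^ 2 := by
    by_contra hcon
    push Not at hcon
    have h1 := hlow z hz1 hcon
    have h2 := hclose y hRy
    have h3 : horizontalQuadratic Q y = ‖y‖ ^ 2 * horizontalQuadratic Q z := by
      conv_lhs => rw [hyz]
      exact horizontalQuadratic_smul Q _ _
    have hy' : u y = 0 := hy
    rw [hy', zero_sub, abs_neg, abs_of_nonneg (horizontalQuadratic_nonneg hQ y), h3] at h2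
    have h4 : 0 < ‖y‖ ^ 2 := by positivity
    nlinarith
  have hhom : dirDeriv e (dirDeriv e newtonFund) y =
      (‖y‖ ^ Module.finrank ℝ 𝔼)⁻¹ * dirDeriv e (dirDeriv e newtonFund) z := by
    have h1 := isHomogeneous_fderiv_fderiv_newtonFund hd ‖y‖ hy0 z hz0
    rw [← hyz] at h1
    rw [dirDeriv, dirDeriv, fderiv_dirDeriv (contDiffAt_newtonFund (norm_pos_iff.1 hy0)),
      fderiv_dirDeriv (contDiffAt_newtonFund hz0), h1]
    rfl
  have hval := dirDeriv_dirDeriv_newtonFund_of_norm_eq_one hd hz1 e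
  have hinner : ⟪z, e⟫ = z (Fin.last n) := by
    simp [e, EuclideanSpace.inner_single_right]
  have he : ‖e‖ = 1 := by simp [e]
  rw [hinner, he] at hval
  rw [hhom, hval, div_eq_inv_mul]
  gcongr
  have hd' : (3 : ℝ) ≤ (Module.finrank ℝ 𝔼 : ℝ) := by exact_mod_cast hd
  set D := (Module.finrank ℝ 𝔼 : ℝ)
  have h1 : 1 / 2 ≤ D * z (Fin.last n) ^ 2 - 1 ^ 2 := by nlinarith
  nlinarith

/-- At `y = x` both sides use the convention `1 / 0 = 0`. -/
theorem newtonKernel_eq_renormalizedKernel (hN : 3 ≤ n + 1) (x : 𝔼) {y : 𝔼} (hy : y ≠ 0) :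
    newtonKernel x y = renormalizedKernel x y := by
  have hd : 3 ≤ Module.finrank ℝ 𝔼 := by simpa using hN
  rw [renormalizedKernel, dirDeriv, fderiv_newtonFund hd hy, newtonFund, newtonFund, newtonKernel,
    norm_sub_rev, finrank_euclideanSpace_fin]
  ring

end Obstacle

/-- The dimension is `N = n + 1 ≥ 3`. -/
theorem proposition3p4 (n : ℕ) (hN : 3 ≤ n + 1)
    (u : EuclideanSpace ℝ (Fin (n + 1)) → ℝ) (hu : IsXNMonotoneSolution u)
    (p : EuclideanSpace ℝ (Fin (n + 1)) → ℝ) (hp : IsBlowDownLimit u p) :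
    HasNewtonPotential (coincidenceSet u) ∧
      ∀ x, u x = p x + newtonPotential (coincidenceSet u) x := by
  obtain ⟨Q, hQ, htr, hlim⟩ := hu.blowDown
  obtain rfl := hp.unique hlim
  have hd : 3 ≤ Module.finrank ℝ (EuclideanSpace ℝ (Fin (n + 1))) := by simpa using hN
  have hclosed := hu.solution.isClosed_coincidenceSet
  have h0 : 0 ∈ coincidenceSet u := hclosed.frontier_subset hu.zero_mem_frontier
  have hw := hu.solution.isSubquadraticPotential h0 hQ htr hlim
  obtain ⟨M, hM⟩ := hlim.exists_le_dirDeriv_newtonFund hN hQ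
  have hint := hw.integrableOn_inv_norm_pow hd hclosed.measurableSet one_half_pos hM
  have hker : ∀ x, ∀ᵐ y, newtonKernel x y = renormalizedKernel x y := fun x => by
    filter_upwards [ae_ne_ne hd x] with y hy
      using newtonKernel_eq_renormalizedKernel hN x hy.1
  refine ⟨⟨hclosed.measurableSet, fun x => ?_⟩, fun x => ?_⟩
  · rw [integrable_indicator_iff hclosed.measurableSet]
    refine (tendsto_setIntegral_truncKernel hd hint x).1.congr ?_
    filter_upwards [ae_restrict_of_ae (hker x)] with y hy using hy.symm
  · have h1 := hw.setIntegral_renormalizedKernel hd hint x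
    rw [newtonPotential, integral_congr_ae (ae_restrict_of_ae (hker x)), h1,
      finrank_euclideanSpace_fin]
    have hn : (3 : ℝ) ≤ ((n + 1 : ℕ) : ℝ) := by exact_mod_cast hN
    have hV : 0 < volume.real (Metric.ball (0 : EuclideanSpace ℝ (Fin (n + 1))) 1) :=
      ENNReal.toReal_pos (Metric.measure_ball_pos volume _ one_pos).ne' measure_ball_lt_top.ne
    have hne : ((n + 1 : ℕ) : ℝ) * (((n + 1 : ℕ) : ℝ) - 2) *
        volume.real (Metric.ball (0 : EuclideanSpace ℝ (Fin (n + 1))) 1) ≠ 0 := by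
      have h2 : (0 : ℝ) < ((n + 1 : ℕ) : ℝ) - 2 := by linarith
      positivity
    rw [one_div, inv_mul_cancel_left₀ hne]
    ring
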